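/- Let $\Gamma$ be a discrete group and let $D \lhd \ell^\infty(\Gamma)$ be an algebraic ideal. A unitary representation $\pi\colon \Gamma\to B(\mathcal H)$ is a \emph{$D$-representation} if $\mathcal H$ has a dense linear subspace $\mathcal H_0$ such that the coefficient function $\pi_{x,x}\colon s\mapsto\langle \pi(s)x,x\rangle$ belongs to $D$ for every $x\in\mathcal H_0$. Let $C^*_D(\Gamma)$ be the (Hausdorff) completion of the group ring $\mathbb C[\Gamma]$ with respect to the $C^*$-seminorm $\|x\|_D=\sup\{\|\pi(x)\| : \pi \text{ is a } D\text{-representation}\}$, and let $C^*(\Gamma)$ be the full group $C^*$-algebra, i.e. the completion with respect to the supremum over all unitary representations. A unitary representation $\pi\colon\Gamma\to B(\mathcal H)$ is \emph{amenable} (in the sense of Bekka) if there is a state $\mu$ on $B(\mathcal H)$ with $\mu(\pi(s)T\pi(s^{-1}))=\mu(T)$ for all $s\in\Gamma$ and $T\in B(\mathcal H)$. The $D$-representations \emph{weakly contain} $\pi$ if for every $x\in\mathcal H$, every finite $F\subseteq\Gamma$ and every $\varepsilon>0$ there are finitely many $D$-representations $\sigma_1,\dots,\sigma_n$ (repetitions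 allowed) and vectors $y_i$ in the space of $\sigma_i$ such that $|\pi_{x,x}(s)-\sum_{i=1}^n(\sigma_i)_{y_i,y_i}(s)|<\varepsilon$ for all $s\in F$. Then $C^*_D(\Gamma)=C^*(\Gamma)$ (that is, the identity map of $\mathbb C[\Gamma]$ extends to a $*$-isomorphism $C^*_D(\Gamma)\to C^*(\Gamma)$) if and only if the $D$-representations weakly contain an amenable representation. -/

import Mathlib

open scoped ComplexOrder ENNReal

universe u

noncomputable section

/-! ### Unitary representations of a discrete group -/

/-- A unitary representation of the (discrete) group `Γ` on a complex Hilbert space. The Hilbert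
spaces are taken in the universe of `Γ`, which changes neither the seminorms nor weak containment
below: in an arbitrary (`D`-)representation, each vector lies in a closed invariant subspace of
density character at most `max |Γ| ℵ₀` on which the representation is again a (`D`-)representation,
and such a subspace is isometric to one in the universe of `Γ`. -/
structure UnitaryRep (Γ : Type u) [Group Γ] where
  /-- The Hilbert space of the representation. -/
  space : Type u
  [normedAddCommGroup : NormedAddCommGroup space]
  [innerProductSpace : InnerProductSpace ℂ space]
  [completeSpace : CompleteSpace space]
  /-- The homomorphism into the unitary group of the Hilbert space. -/
  hom : Γ →* unitary (space →L[ℂ] space)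

namespace UnitaryRep

attribute [instance] normedAddCommGroup innerProductSpace completeSpace

variable {Γ : Type u} [Group Γ]

/-- The operator `π(s)`. -/
def op (π : UnitaryRep Γ) (s : Γ) : π.space →L[ℂ] π.space :=
  (π.hom s : π.space →L[ℂ] π.space)

/-- The extension of `π` to the group ring `ℂ[Γ]`, that is `∑ aₛ s ↦ ∑ aₛ π(s)`. -/
def onGroupRing (π : UnitaryRep Γ) : MonoidAlgebra ℂ Γ →ₐ[ℂ] (π.space →L[ℂ] π.space) :=
  MonoidAlgebra.lift ℂ (π.space →L[ℂ] π.space) Γ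
    ((unitary (π.space →L[ℂ] π.space)).subtype.comp π.hom)

lemma onGroupRing_single (π : UnitaryRep Γ) (s : Γ) (a : ℂ) :
    π.onGroupRing (MonoidAlgebra.single s a) = a • π.op s := by
  simp [onGroupRing, op]

lemma norm_op_le (π : UnitaryRep Γ) (s : Γ) : ‖π.op s‖ ≤ 1 :=
  (π.op s).opNorm_le_bound zero_le_one fun x => by
    rw [one_mul]
    exact (ContinuousLinearMap.norm_map_of_mem_unitary (π.hom s).2 x).le

lemma star_op (π : UnitaryRep Γ) (s : Γ) : star (π.op s) = π.op s⁻¹ := by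
  rw [op, op, map_inv, ← Unitary.coe_star, Unitary.star_eq_inv]

/-- The diagonal coefficient function `π_{x,x}(s) = ⟨π(s)x, x⟩` (inner product linear in the first
variable; Mathlib's `inner` is linear in the second one). -/
def coeff (π : UnitaryRep Γ) (x : π.space) (s : Γ) : ℂ := inner ℂ x (π.op s x)

lemma memℓp_coeff (π : UnitaryRep Γ) (x : π.space) : Memℓp (π.coeff x) ∞ := by
  refine memℓp_infty ⟨‖x‖ * ‖x‖, ?_⟩
  rintro _ ⟨s, rfl⟩
  refine (norm_inner_le_norm _ _).trans ?_
  gcongr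
  simpa using (π.op s).le_of_opNorm_le (π.norm_op_le s) x

/-- `π_{x,x}` as an element of `ℓ^∞(Γ)`. -/
def coeffInf (π : UnitaryRep Γ) (x : π.space) : lp (fun _ : Γ => ℂ) ∞ :=
  ⟨π.coeff x, π.memℓp_coeff x⟩

/-- `π` is a `D`-representation: there is a dense linear subspace of vectors `x` with
`π_{x,x} ∈ D`. -/
def IsDRep (D : Ideal (lp (fun _ : Γ => ℂ) ∞)) (π : UnitaryRep Γ) : Prop :=
  ∃ H₀ : Submodule ℂ π.space, Dense (H₀ : Set π.space) ∧ ∀ x ∈ H₀, π.coeffInf x ∈ D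

/-- The class of all `D`-representations. -/
def dReps (D : Ideal (lp (fun _ : Γ => ℂ) ∞)) : Set (UnitaryRep Γ) := {π | π.IsDRep D}

/-- `π` is amenable (in the sense of Bekka): there is a state `μ` on `B(H)`, that is a positive
linear functional with `μ(1) = 1`, such that `μ(π(s) T π(s⁻¹)) = μ(T)` for all `s` and `T`. -/
def IsAmenable (π : UnitaryRep Γ) : Prop :=
  ∃ μ : (π.space →L[ℂ] π.space) →ₚ[ℂ] ℂ, μ 1 = 1 ∧
    ∀ (s : Γ) (T : π.space →L[ℂ] π.space), μ (π.op s * T * π.op s⁻¹) = μ T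

/-- The class `S` weakly contains `π`: every function of positive type `π_{x,x}` is a limit,
uniformly on finite subsets of `Γ`, of finite sums of functions of positive type `σ_{y,y}` with
`σ ∈ S`. -/
def WeaklyContains (S : Set (UnitaryRep Γ)) (π : UnitaryRep Γ) : Prop :=
  ∀ (x : π.space) (F : Finset Γ) (ε : ℝ), 0 < ε →
    ∃ (n : ℕ) (σ : Fin n → UnitaryRep Γ) (y : (i : Fin n) → (σ i).space),
      (∀ i, σ i ∈ S) ∧
      ∀ s ∈ F, ‖π.coeff x s - ∑ i, (σ i).coeff (y i) s‖ < ε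

end UnitaryRep

/-! ### The group ring as a *-algebra with the seminorm `‖·‖_S` -/

/-- The group ring `ℂ[Γ]`, to be endowed with the seminorm `‖x‖_S = sup {‖π(x)‖ | π ∈ S}`. -/
def PreGroupCStar {Γ : Type u} [Group Γ] (_S : Set (UnitaryRep Γ)) : Type u := MonoidAlgebra ℂ Γ

namespace PreGroupCStar

variable {Γ : Type u} [Group Γ] (S : Set (UnitaryRep Γ))

instance : Ring (PreGroupCStar S) := inferInstanceAs (Ring (MonoidAlgebra ℂ Γ))

instance : Algebra ℂ (PreGroupCStar S) := inferInstanceAs (Algebra ℂ (MonoidAlgebra ℂ Γ))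

/-- The identity map from `ℂ[Γ]` to its copy that carries the seminorm. -/
def of : MonoidAlgebra ℂ Γ ≃ₐ[ℂ] PreGroupCStar S := AlgEquiv.refl

variable {S}

/-- The action of an element of (the copy of) the group ring in a representation. -/
def act (π : UnitaryRep Γ) : PreGroupCStar S →ₐ[ℂ] (π.space →L[ℂ] π.space) :=
  π.onGroupRing.comp (of S).symm.toAlgHom

@[elab_as_elim]
lemma induction {p : PreGroupCStar S → Prop} (x : PreGroupCStar S)
    (zero : p 0) (single : ∀ s a, p (of S (MonoidAlgebra.single s a)))
    (add : ∀ x y, p x → p y → p (x + y)) : p x := by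
  refine MonoidAlgebra.induction_linear (motive := fun z => p (of S z))
    ((of S).symm x) ?_ ?_ ?_
  · exact zero
  · exact fun f g hf hg => add _ _ hf hg
  · exact single

lemma act_single (π : UnitaryRep Γ) (s : Γ) (a : ℂ) :
    act π (of S (MonoidAlgebra.single s a)) = a • π.op s :=
  π.onGroupRing_single s a

/-- The involution `(∑ aₛ s)⋆ = ∑ conj(aₛ) s⁻¹` on the group ring. -/
instance : Star (PreGroupCStar S) :=
  ⟨fun x => of S (((of S).symm x).coeff.sum fun s a => MonoidAlgebra.single s⁻¹ (star a))⟩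

lemma star_single (s : Γ) (a : ℂ) :
    star (of S (MonoidAlgebra.single s a)) = of S (MonoidAlgebra.single s⁻¹ (star a)) := by
  change of S ((MonoidAlgebra.single s a).coeff.sum _) = _
  simp

lemma star_add' (x y : PreGroupCStar S) : star (x + y) = star x + star y := by
  change of S ((((of S).symm x).coeff + ((of S).symm y).coeff).sum _) = _
  classical
  rw [Finsupp.sum_add_index (by simp) (by simp)]
  rfl

lemma star_zero' : star (0 : PreGroupCStar S) = 0 := by
  simpa using star_add' (0 : PreGroupCStar S) 0

lemma star_mul' (x y : PreGroupCStar S) : star (x * y) = star y * star x := by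
  induction x using induction with
  | zero => simp [star_zero']
  | add x x' hx hx' => rw [add_mul, star_add', star_add', mul_add, hx, hx']
  | single s a =>
    induction y using induction with
    | zero => simp [star_zero']
    | add y y' hy hy' => rw [mul_add, star_add', star_add', add_mul, hy, hy']
    | single t b =>
      rw [← map_mul, MonoidAlgebra.single_mul_single, star_single, star_single, star_single,
        ← map_mul, MonoidAlgebra.single_mul_single, mul_inv_rev, star_mul]

instance : StarRing (PreGroupCStar S) where
  star_involutive x := by
    induction x using induction with
    | zero => simp [star_zero']
    | add x y hx hy => rw [star_add', star_add', hx, hy]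
    | single s a => simp [star_single]
  star_mul := star_mul'
  star_add := star_add'

instance : StarModule ℂ (PreGroupCStar S) where
  star_smul c x := by
    induction x using induction with
    | zero => simp
    | add x y hx hy => rw [smul_add, star_add, hx, hy, star_add, smul_add]
    | single s a => simp [← map_smul, star_single]

lemma act_star (π : UnitaryRep Γ) (x : PreGroupCStar S) : act π (star x) = star (act π x) := by
  induction x using induction with
  | zero => simp
  | add x y hx hy => simp [hx, hy]
  | single s a => rw [star_single, act_single, act_single, star_smul, π.star_op]

/-- The seminorm `‖x‖_S = sup {‖π(x)‖ | π ∈ S}`. -/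
instance : Norm (PreGroupCStar S) := ⟨fun x => ⨆ π : S, ‖act π.1 x‖⟩

lemma norm_def (x : PreGroupCStar S) : ‖x‖ = ⨆ π : S, ‖act π.1 x‖ := rfl

lemma bddAbove (x : PreGroupCStar S) : BddAbove (Set.range fun π : S => ‖act π.1 x‖) := by
  induction x using induction with
  | zero => exact ⟨0, by rintro _ ⟨π, rfl⟩; simp⟩
  | add x y hx hy =>
    obtain ⟨a, ha⟩ := hx
    obtain ⟨b, hb⟩ := hy
    refine ⟨a + b, ?_⟩
    rintro _ ⟨π, rfl⟩
    simp only [map_add]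
    exact (norm_add_le _ _).trans (add_le_add (ha ⟨π, rfl⟩) (hb ⟨π, rfl⟩))
  | single s a =>
    refine ⟨‖a‖, ?_⟩
    rintro _ ⟨π, rfl⟩
    simp only [act_single, norm_smul]
    exact mul_le_of_le_one_right (norm_nonneg _) (π.1.norm_op_le s)

lemma norm_act_le {π : UnitaryRep Γ} (hπ : π ∈ S) (x : PreGroupCStar S) : ‖act π x‖ ≤ ‖x‖ :=
  le_ciSup (bddAbove x) (⟨π, hπ⟩ : S)

lemma norm_nonneg' (x : PreGroupCStar S) : 0 ≤ ‖x‖ := Real.iSup_nonneg fun _ => norm_nonneg _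

lemma norm_le {x : PreGroupCStar S} {c : ℝ} (hc : 0 ≤ c) (h : ∀ π ∈ S, ‖act π x‖ ≤ c) : ‖x‖ ≤ c :=
  Real.iSup_le (fun π => h π.1 π.2) hc

instance : SeminormedRing (PreGroupCStar S) :=
  { (inferInstance : Ring (PreGroupCStar S)),
    SeminormedAddCommGroup.ofCore (𝕜 := ℂ)
      { norm_nonneg := norm_nonneg'
        norm_smul := fun c x => by
          simp only [norm_def, map_smul, norm_smul]
          rw [Real.mul_iSup_of_nonneg (norm_nonneg c)]
        norm_triangle := fun x y =>
          norm_le (add_nonneg (norm_nonneg' x) (norm_nonneg' y)) fun π hπ => by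
            rw [map_add]
            exact (norm_add_le _ _).trans (add_le_add (norm_act_le hπ x) (norm_act_le hπ y)) } with
    norm_mul_le := fun x y => 
      norm_le (mul_nonneg (norm_nonneg' x) (norm_nonneg' y)) fun π hπ => by
        rw [map_mul]
        exact (norm_mul_le _ _).trans (mul_le_mul (norm_act_le hπ x) (norm_act_le hπ y)
          (norm_nonneg _) (norm_nonneg' x)) }

instance : NormedAlgebra ℂ (PreGroupCStar S) where
  norm_smul_le c x := 
    norm_le (mul_nonneg (norm_nonneg c) (norm_nonneg' x)) fun π hπ => by
      rw [map_smul, norm_smul]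
      exact mul_le_mul_of_nonneg_left (norm_act_le hπ x) (norm_nonneg c)

instance : NormedStarGroup (PreGroupCStar S) where
  norm_star_le x := norm_le (norm_nonneg' x) fun π hπ => by
    rw [act_star, norm_star]
    exact norm_act_le hπ x

lemma norm_mul_self_le' (x : PreGroupCStar S) : ‖x‖ * ‖x‖ ≤ ‖star x * x‖ := by
  refine (mul_self_le_mul_self (norm_nonneg' x) (b := Real.sqrt ‖star x * x‖) ?_).trans_eq
    (Real.mul_self_sqrt (norm_nonneg' _))
  refine norm_le (Real.sqrt_nonneg _) fun π hπ => Real.le_sqrt_of_sq_le ?_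
  rw [sq, ← CStarRing.norm_star_mul_self, ← act_star, ← map_mul]
  exact norm_act_le hπ _

end PreGroupCStar

/-! ### The C⋆-algebra `C*_S(Γ)` -/

/-- `C*_S(Γ)`: the (Hausdorff) completion of `ℂ[Γ]` with respect to the C⋆-seminorm `‖·‖_S`. -/
def GroupCStar {Γ : Type u} [Group Γ] (S : Set (UnitaryRep Γ)) : Type u :=
  UniformSpace.Completion (PreGroupCStar S)

namespace GroupCStar

open UniformSpace

variable {Γ : Type u} [Group Γ] (S : Set (UnitaryRep Γ))

instance : NormedRing (GroupCStar S) :=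
  inferInstanceAs (NormedRing (Completion (PreGroupCStar S)))

instance : CompleteSpace (GroupCStar S) :=
  inferInstanceAs (CompleteSpace (Completion (PreGroupCStar S)))

instance : Algebra ℂ (GroupCStar S) :=
  inferInstanceAs (Algebra ℂ (Completion (PreGroupCStar S)))

instance : NormedAlgebra ℂ (GroupCStar S) where
  norm_smul_le c x := norm_smul_le (β := Completion (PreGroupCStar S)) c x

/-- The involution of `C*_S(Γ)` is the continuous extension of the involution of `ℂ[Γ]`. -/
instance : Star (GroupCStar S) :=
  ⟨Completion.map (star : PreGroupCStar S → PreGroupCStar S)⟩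

variable {S}

/-- The canonical map from the seminormed group ring. -/
def coe (x : PreGroupCStar S) : GroupCStar S := (x : Completion (PreGroupCStar S))

variable (S) in
/-- The canonical map `ℂ[Γ] → C*_S(Γ)`. -/
def of (x : MonoidAlgebra ℂ Γ) : GroupCStar S := coe (PreGroupCStar.of S x)

lemma coe_add (x y : PreGroupCStar S) : coe (x + y) = coe x + coe y := Completion.coe_add x y

lemma coe_mul (x y : PreGroupCStar S) : coe (x * y) = coe x * coe y := Completion.coe_mul x y

lemma coe_smul (c : ℂ) (x : PreGroupCStar S) : coe (c • x) = c • coe x := Completion.coe_smul c x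

lemma norm_coe (x : PreGroupCStar S) : ‖coe x‖ = ‖x‖ := Completion.norm_coe x

lemma star_coe (x : PreGroupCStar S) : star (coe x) = coe (star x) :=
  Completion.map_coe (starNormedAddGroupHom (E := PreGroupCStar S)).uniformContinuous x

lemma denseRange_coe : DenseRange (coe : PreGroupCStar S → GroupCStar S) :=
  Completion.denseRange_coe

instance : ContinuousStar (GroupCStar S) :=
  ⟨Completion.continuous_map⟩

instance : StarRing (GroupCStar S) where
  star_involutive x := by
    refine denseRange_coe.induction_on x (isClosed_eq (by fun_prop) (by fun_prop)) fun a => ?_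
    rw [star_coe, star_coe, star_star]
  star_mul x y := by
    refine denseRange_coe.induction_on₂ (isClosed_eq (by fun_prop) (by fun_prop))
      (fun a b => ?_) x y
    rw [star_coe, star_coe, ← coe_mul, star_coe, ← coe_mul, star_mul]
  star_add x y := by
    refine denseRange_coe.induction_on₂ (isClosed_eq (by fun_prop) (by fun_prop))
      (fun a b => ?_) x y
    rw [star_coe, star_coe, ← coe_add, star_coe, ← coe_add, star_add]

instance : CStarRing (GroupCStar S) where
  norm_mul_self_le x := by
    refine denseRange_coe.induction_on x (isClosed_le (by fun_prop) (by fun_prop)) fun a => ?_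
    rw [star_coe, ← coe_mul, norm_coe, norm_coe]
    exact PreGroupCStar.norm_mul_self_le' a

instance : StarModule ℂ (GroupCStar S) where
  star_smul c x := by
    refine denseRange_coe.induction_on x (isClosed_eq (continuous_const_smul c).star
      (continuous_star.const_smul (star c))) fun a => ?_
    rw [star_coe, ← coe_smul, star_coe, ← coe_smul, star_smul]

instance : CStarAlgebra (GroupCStar S) where

end GroupCStar

/-- The ideal completion `C*_D(Γ)` is `C*_S(Γ)` for `S` the class of `D`-representations. -/
abbrev IdealCompletion {Γ : Type u} [Group Γ] (D : Ideal (lp (fun _ : Γ => ℂ) ∞)) : Type u :=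
  GroupCStar (UnitaryRep.dReps D)

/-- The full group C⋆-algebra `C*(Γ)`: the completion for the supremum over all unitary
representations. -/
abbrev FullGroupCStar (Γ : Type u) [Group Γ] : Type u :=
  GroupCStar (Set.univ : Set (UnitaryRep Γ))

end

/-! Coefficients of a tensor product are sums of products of coefficients, and `D` is an ideal, so
`σ ⊗ τ` is a `D`-representation as soon as `σ` is (`IsDRep.tensor`). Hence, if the
`D`-representations weakly contain `π`, they also approximate the coefficients of algebraic vectors
of `π ⊗ τ`, for arbitrary `τ` (`sum_gram_mul_mem_closure`). For amenable `π`, Bekka's theorem says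
that the trivial representation is weakly contained in `π ⊗ π̄` (`IsAmenable.one_mem_closure`).
Taking `τ = π̄ ⊗ ρ`, every `ρ = 1 ⊗ ρ` is weakly contained in the `D`-representations
(`weaklyContains_of_isAmenable`), and weak containment bounds `‖ρ(x)‖` by the `D`-seminorm.

Bekka's theorem rests on Day's convexity argument, which replaces an invariant state by finite-rank
states that are almost invariant in norm (`IsAmenable.exists_norm_sub_lt`). By the Powers–Størmer
inequality their square roots are almost invariant Hilbert–Schmidt operators, that is, vectors of `H
⊗ H̄`. All operators involved are finite sums of rank-one operators, so traces are needed only in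
finite dimensions.

Conversely, a `*`-isomorphism is isometric, so the two seminorms agree. The trivial representation,
which is amenable, is then bounded by the `D`-seminorm, and Hahn–Banach separation turns this bound
into weak containment (`weaklyContains_of_norm_act_le`). -/

noncomputable section

/-! ### Coefficient functions and isometric actions -/

namespace UnitaryRep

variable {Γ : Type u} [Group Γ]

@[simp]
lemma op_one (π : UnitaryRep Γ) : π.op 1 = 1 := by simp [op]

lemma op_mul (π : UnitaryRep Γ) (s t : Γ) : π.op (s * t) = π.op s * π.op t := by simp [op]

lemma op_mul_apply (π : UnitaryRep Γ) (s t : Γ) (x : π.space) :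
    π.op (s * t) x = π.op s (π.op t x) := by simp [op_mul]

@[simp]
lemma inner_op_op (π : UnitaryRep Γ) (s : Γ) (x y : π.space) :
    inner ℂ (π.op s x) (π.op s y) = inner ℂ x y :=
  ContinuousLinearMap.inner_map_map_of_mem_unitary (π.hom s).2 x y

@[simp]
lemma norm_op_apply (π : UnitaryRep Γ) (s : Γ) (x : π.space) : ‖π.op s x‖ = ‖x‖ :=
  ContinuousLinearMap.norm_map_of_mem_unitary (π.hom s).2 x

lemma inner_op_left (π : UnitaryRep Γ) (s : Γ) (x y : π.space) :
    inner ℂ (π.op s x) y = inner ℂ x (π.op s⁻¹ y) := by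
  rw [← π.inner_op_op s⁻¹, ← op_mul_apply]
  simp

/-- The off-diagonal coefficient function `π_{x,y}(s) = ⟨π(s)x, y⟩`. -/
def coeff₂ (π : UnitaryRep Γ) (x y : π.space) (s : Γ) : ℂ := inner ℂ y (π.op s x)

lemma coeff_eq_coeff₂ (π : UnitaryRep Γ) (x : π.space) : π.coeff x = π.coeff₂ x x := rfl

lemma norm_coeff₂_le (π : UnitaryRep Γ) (x y : π.space) (s : Γ) :
    ‖π.coeff₂ x y s‖ ≤ ‖x‖ * ‖y‖ := by
  refine (norm_inner_le_norm _ _).trans ?_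
  rw [norm_op_apply, mul_comm]

/-- Polarization: the definition of a `D`-representation controls diagonal coefficients only,
whereas tensor products also produce off-diagonal ones. -/
lemma coeff₂_eq_sum_coeff (π : UnitaryRep Γ) (x y : π.space) :
    π.coeff₂ x y = fun s => (4 : ℂ)⁻¹ * (π.coeff (x + y) s - π.coeff (x - y) s
      + Complex.I * π.coeff (x + Complex.I • y) s
      - Complex.I * π.coeff (x - Complex.I • y) s) := by
  funext s
  simp only [coeff, coeff₂, map_add, map_sub, map_smul, inner_add_left, inner_add_right,
    inner_sub_left, inner_sub_right, inner_smul_left, inner_smul_right, Complex.conj_I]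
  linear_combination (exp := 1) ((inner ℂ y (π.op s x)) / 2 - inner ℂ x (π.op s y) / 2) *
    Complex.I_sq

/-- A unitary representation from a multiplicative family of isometric operators. -/
def ofIsometric (H : Type u) [NormedAddCommGroup H] [InnerProductSpace ℂ H] [CompleteSpace H]
    (U : Γ →* (H →L[ℂ] H)) (hU : ∀ s x, ‖U s x‖ = ‖x‖) : UnitaryRep Γ where
  space := H
  hom := U.codRestrict (unitary (H →L[ℂ] H)) fun s => by
    have h1 : ∀ s, star (U s) * U s = 1 := fun s =>
      (ContinuousLinearMap.norm_map_iff_adjoint_comp_self _).1 (hU s)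
    have h2 : star (U s) = U s⁻¹ := by
      -- An isometry need not be onto; here the group inverse supplies the right inverse that makes
      -- `U s` unitary.
      calc star (U s) = star (U s) * (U s * U s⁻¹) := by rw [← map_mul]; simp
        _ = U s⁻¹ := by rw [← mul_assoc, h1, one_mul]
    refine Unitary.mem_iff.2 ⟨h1 s, ?_⟩
    rw [h2, ← map_mul]
    simp

end UnitaryRep

/-! ### The conjugate representation -/

/-- The conjugate of a complex inner product space. -/
def ConjSpace (H : Type u) : Type u := H

namespace ConjSpace

variable {H : Type u}

/-- The identity map, as a map into the conjugate space. -/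
def mk (x : H) : ConjSpace H := x

/-- The identity map, as a map from the conjugate space. -/
def out (x : ConjSpace H) : H := x

lemma out_injective : Function.Injective (out : ConjSpace H → H) := fun _ _ h => h

variable [NormedAddCommGroup H] [InnerProductSpace ℂ H]

instance : NormedAddCommGroup (ConjSpace H) := inferInstanceAs (NormedAddCommGroup H)

instance [CompleteSpace H] : CompleteSpace (ConjSpace H) := inferInstanceAs (CompleteSpace H)

omit [InnerProductSpace ℂ H] in
lemma out_add (x y : ConjSpace H) : (x + y).out = x.out + y.out := rfl

omit [InnerProductSpace ℂ H] in
lemma norm_out (x : ConjSpace H) : ‖x.out‖ = ‖x‖ := rfl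

instance : SMul ℂ (ConjSpace H) := ⟨fun c x => mk (star c • x.out)⟩

lemma out_smul (c : ℂ) (x : ConjSpace H) : (c • x).out = star c • x.out := rfl

instance : Module ℂ (ConjSpace H) where
  one_smul x := out_injective (by simp [out_smul])
  mul_smul a b x := out_injective (by simp [out_smul, mul_smul])
  smul_zero a := out_injective (smul_zero (A := H) (star a))
  smul_add a x y := out_injective (by simp [out_smul, out_add])
  add_smul a b x := out_injective (by simp [out_smul, out_add, add_smul])
  zero_smul x := out_injective (by rw [out_smul, star_zero, zero_smul]; rfl)

instance : NormedSpace ℂ (ConjSpace H) where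
  norm_smul_le a x := by rw [← norm_out, out_smul, norm_smul, norm_star, norm_out]

instance : InnerProductSpace ℂ (ConjSpace H) where
  inner x y := inner ℂ y.out x.out
  norm_sq_eq_re_inner x := norm_sq_eq_re_inner (𝕜 := ℂ) x.out
  conj_inner_symm _ _ := inner_conj_symm _ _
  add_left _ _ _ := inner_add_right _ _ _
  smul_left _ _ _ := inner_smul_right _ _ _

/-- A bounded operator, acting on the conjugate space. -/
def conjOp : (H →L[ℂ] H) →* (ConjSpace H →L[ℂ] ConjSpace H) where
  toFun T :=
    { toFun := fun x => mk (T x.out)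
      map_add' := fun x y => map_add T x.out y.out
      map_smul' := fun c x => map_smul T (star c) x.out
      cont := T.continuous }
  map_one' := rfl
  map_mul' _ _ := rfl

end ConjSpace

namespace UnitaryRep

variable {Γ : Type u} [Group Γ]

/-- The conjugate of a unitary representation. -/
def conj (π : UnitaryRep Γ) : UnitaryRep Γ :=
  ofIsometric (ConjSpace π.space)
    (ConjSpace.conjOp.comp ((unitary (π.space →L[ℂ] π.space)).subtype.comp π.hom))
    fun s x => π.norm_op_apply s x.out

/-- The identity map into the space of the conjugate representation. -/
def toConj (π : UnitaryRep Γ) (x : π.space) : π.conj.space := ConjSpace.mk x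

lemma coeff₂_toConj (π : UnitaryRep Γ) (x y : π.space) :
    π.conj.coeff₂ (π.toConj x) (π.toConj y) = star (π.coeff₂ x y) :=
  funext fun _ => (inner_conj_symm _ _).symm

/-! ### The tensor product of representations -/

open TensorProduct UniformSpace

/-- The operator `σ(s) ⊗ τ(s)` on the algebraic tensor product. -/
def tensorIsometry (σ τ : UnitaryRep Γ) (s : Γ) :
    σ.space ⊗[ℂ] τ.space →ₗᵢ[ℂ] σ.space ⊗[ℂ] τ.space :=
  mapIsometry ⟨σ.op s, σ.norm_op_apply s⟩ ⟨τ.op s, τ.norm_op_apply s⟩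

lemma tensorIsometry_tmul (σ τ : UnitaryRep Γ) (s : Γ) (x : σ.space) (y : τ.space) :
    σ.tensorIsometry τ s (x ⊗ₜ y) = σ.op s x ⊗ₜ τ.op s y := rfl

lemma tensorIsometry_one (σ τ : UnitaryRep Γ) : σ.tensorIsometry τ 1 = .id := by
  apply LinearIsometry.toLinearMap_injective
  ext x y
  simp [tensorIsometry_tmul]

lemma tensorIsometry_mul (σ τ : UnitaryRep Γ) (s t : Γ) :
    σ.tensorIsometry τ (s * t) = (σ.tensorIsometry τ s).comp (σ.tensorIsometry τ t) := by
  apply LinearIsometry.toLinearMap_injective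
  ext x y
  simp [tensorIsometry_tmul, op_mul_apply]

/-- The tensor product of two unitary representations. -/
def tensor (σ τ : UnitaryRep Γ) : UnitaryRep Γ :=
  ofIsometric (Completion (σ.space ⊗[ℂ] τ.space))
    { toFun := fun s => (σ.tensorIsometry τ s).toContinuousLinearMap.completion
      map_one' := by
        ext x
        refine Completion.induction_on x (isClosed_eq (by fun_prop) (by fun_prop)) fun a => ?_
        simp [tensorIsometry_one]
      map_mul' := fun s t => by
        ext x
        refine Completion.induction_on x (isClosed_eq (by fun_prop) (by fun_prop)) fun a => ?_
        simp [tensorIsometry_mul] }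
    fun s x => by
      refine Completion.induction_on x (isClosed_eq (by fun_prop) (by fun_prop)) fun a => ?_
      simp

/-- The canonical map from the algebraic tensor product. -/
def toTensor (σ τ : UnitaryRep Γ) : σ.space ⊗[ℂ] τ.space →L[ℂ] (σ.tensor τ).space :=
  Completion.toComplL

lemma coeff₂_toTensor (σ τ : UnitaryRep Γ) (x x' : σ.space) (y y' : τ.space) :
    (σ.tensor τ).coeff₂ (σ.toTensor τ (x ⊗ₜ y)) (σ.toTensor τ (x' ⊗ₜ y')) =
      σ.coeff₂ x x' * τ.coeff₂ y y' := by
  funext s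
  change inner ℂ (((x' ⊗ₜ y' : σ.space ⊗[ℂ] τ.space)) : Completion (σ.space ⊗[ℂ] τ.space))
    ((σ.tensorIsometry τ s).toContinuousLinearMap.completion _) = _
  erw [ContinuousLinearMap.completion_apply_coe]
  rw [Completion.inner_coe]
  rfl

lemma coeff₂_sum {ι : Type*} (π : UnitaryRep Γ) (t t' : Finset ι) (x y : ι → π.space) :
    π.coeff₂ (∑ k ∈ t, x k) (∑ l ∈ t', y l) = ∑ k ∈ t, ∑ l ∈ t', π.coeff₂ (x k) (y l) := by
  funext s
  simp only [coeff₂, map_sum, sum_inner, inner_sum, Finset.sum_apply]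

lemma coeff_toTensor_sum {ι : Type*} [Fintype ι] (σ τ : UnitaryRep Γ) (x : ι → σ.space)
    (y : ι → τ.space) :
    (σ.tensor τ).coeff (σ.toTensor τ (∑ k, x k ⊗ₜ y k)) =
      ∑ k, ∑ l, σ.coeff₂ (x k) (x l) * τ.coeff₂ (y k) (y l) := by
  rw [coeff_eq_coeff₂, map_sum, coeff₂_sum]
  simp_rw [coeff₂_toTensor]

lemma denseRange_toTensor (σ τ : UnitaryRep Γ) : DenseRange (σ.toTensor τ) :=
  Completion.denseRange_coe

end UnitaryRep

/-! ### Tensoring a `D`-representation with an arbitrary one -/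

/-- The functions on `Γ` that belong to the ideal `D` of `ℓ^∞(Γ)`. -/
def idealFunctions {Γ : Type u} (D : Ideal (lp (fun _ : Γ => ℂ) ∞)) : Submodule ℂ (Γ → ℂ) where
  carrier := {f | ∃ h : Memℓp f ∞, (⟨f, h⟩ : lp (fun _ : Γ => ℂ) ∞) ∈ D}
  add_mem' := fun ⟨hf, hf'⟩ ⟨hg, hg'⟩ => ⟨hf.add hg, D.add_mem hf' hg'⟩
  zero_mem' := ⟨zero_memℓp, D.zero_mem⟩
  smul_mem' := fun c _ ⟨hf, hf'⟩ => ⟨hf.const_smul c, D.smul_of_tower_mem c hf'⟩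

lemma mul_mem_idealFunctions {Γ : Type u} {D : Ideal (lp (fun _ : Γ => ℂ) ∞)} {f g : Γ → ℂ}
    (hf : f ∈ idealFunctions D) (hg : Memℓp g ∞) : f * g ∈ idealFunctions D :=
  ⟨hf.1.infty_mul hg, D.mul_mem_right (⟨g, hg⟩ : lp (fun _ : Γ => ℂ) ∞) hf.2⟩

namespace UnitaryRep

variable {Γ : Type u} [Group Γ]

lemma memℓp_coeff₂ (π : UnitaryRep Γ) (x y : π.space) : Memℓp (π.coeff₂ x y) ∞ :=
  memℓp_infty ⟨‖x‖ * ‖y‖, by rintro _ ⟨s, rfl⟩; exact π.norm_coeff₂_le x y s⟩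

lemma coeff₂_mem_idealFunctions {D : Ideal (lp (fun _ : Γ => ℂ) ∞)} {π : UnitaryRep Γ}
    {H₀ : Submodule ℂ π.space} (h : ∀ x ∈ H₀, π.coeffInf x ∈ D) {x y : π.space} (hx : x ∈ H₀)
    (hy : y ∈ H₀) : π.coeff₂ x y ∈ idealFunctions D := by
  have key : ∀ x ∈ H₀, π.coeff x ∈ idealFunctions D := fun x hx => ⟨π.memℓp_coeff x, h x hx⟩
  have hI := H₀.smul_mem Complex.I hy
  have : π.coeff₂ x y = (4 : ℂ)⁻¹ • (π.coeff (x + y) - π.coeff (x - y)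
      + Complex.I • π.coeff (x + Complex.I • y) - Complex.I • π.coeff (x - Complex.I • y)) :=
    π.coeff₂_eq_sum_coeff x y
  rw [this]
  refine Submodule.smul_mem _ _ (sub_mem (add_mem (sub_mem ?_ ?_) (Submodule.smul_mem _ _ ?_))
    (Submodule.smul_mem _ _ ?_)) <;> apply key
  exacts [add_mem hx hy, sub_mem hx hy, add_mem hx hI, sub_mem hx hI]

-- The dense subspace is the image of the algebraic tensor product of `H₀` with the whole space of
-- `τ`. A coefficient there is a sum of products of a function in `D`, by polarization, with a
-- bounded function.
open TensorProduct in
lemma IsDRep.tensor {D : Ideal (lp (fun _ : Γ => ℂ) ∞)} {σ : UnitaryRep Γ} (hσ : σ.IsDRep D)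
    (τ : UnitaryRep Γ) : (σ.tensor τ).IsDRep D := by
  obtain ⟨H₀, hd, hD⟩ := hσ
  let f : H₀ ⊗[ℂ] τ.space →ₗ[ℂ] (σ.tensor τ).space :=
    (σ.toTensor τ).toLinearMap ∘ₗ TensorProduct.map H₀.subtype LinearMap.id
  refine ⟨LinearMap.range f, ?_, ?_⟩
  · rw [Submodule.dense_iff_topologicalClosure_eq_top]
    have key : LinearMap.range (σ.toTensor τ).toLinearMap ≤
        (LinearMap.range f).topologicalClosure := by
      rintro _ ⟨z, rfl⟩
      induction z using TensorProduct.induction_on with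
      | zero => rw [map_zero]; exact zero_mem _
      | add x y hx hy => rw [map_add]; exact add_mem hx hy
      | tmul x y =>
        refine map_mem_closure (f := fun x => σ.toTensor τ (x ⊗ₜ y)) ?_ (hd x) fun x' hx' => ?_
        · fun_prop
        · exact ⟨⟨x', hx'⟩ ⊗ₜ y, rfl⟩
    refine top_le_iff.1 fun z _ => ?_
    exact closure_minimal key (Submodule.isClosed_topologicalClosure _) (σ.denseRange_toTensor τ z)
  · rintro _ ⟨z, rfl⟩
    obtain ⟨n, x, y, rfl⟩ := TensorProduct.exists_sum_tmul_eq z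
    have : f (∑ j, x j ⊗ₜ[ℂ] y j) = σ.toTensor τ (∑ j, (x j : σ.space) ⊗ₜ[ℂ] y j) := by
      simp [f]
    suffices h : (σ.tensor τ).coeff (f (∑ j, x j ⊗ₜ[ℂ] y j)) ∈ idealFunctions D from h.2
    rw [this, coeff_toTensor_sum]
    exact sum_mem fun k _ => sum_mem fun l _ => mul_mem_idealFunctions
      (coeff₂_mem_idealFunctions hD (x k).2 (x l).2) (τ.memℓp_coeff₂ _ _)

end UnitaryRep

/-! ### Weak containment as membership in a closed cone -/

open Filter Topology in
lemma mem_closure_pi_iff_forall_finset {α E : Type*} [SeminormedAddCommGroup E] {A : Set (α → E)}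
    {x : α → E} : x ∈ closure A ↔ ∀ (F : Finset α) (ε : ℝ), 0 < ε →
      ∃ a ∈ A, ∀ s ∈ F, ‖x s - a s‖ < ε := by
  constructor
  · intro h F ε hε
    have ho : IsOpen {a : α → E | ∀ s ∈ F, ‖x s - a s‖ < ε} := by
      simp only [Set.ofPred_forall]
      exact isOpen_biInter_finset fun s _ => isOpen_lt (by fun_prop) continuous_const
    obtain ⟨a, ha, haA⟩ := mem_closure_iff.1 h _ ho (by simp [hε])
    exact ⟨a, haA, ha⟩
  · intro h
    rw [mem_closure_iff_nhds]
    intro t ht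
    rw [nhds_pi, Filter.mem_pi] at ht
    obtain ⟨I, hI, v, hv, hvt⟩ := ht
    have h1 : ∀ᶠ ε in 𝓝[>] (0 : ℝ), ∀ i ∈ I, Metric.ball (x i) ε ⊆ v i := by
      refine (eventually_all_finite hI).2 fun i _ => ?_
      obtain ⟨δ, hδ, hb⟩ := Metric.mem_nhds_iff.1 (hv i)
      filter_upwards [Ioo_mem_nhdsGT hδ] with ε hε
      exact (Metric.ball_subset_ball hε.2.le).trans hb
    obtain ⟨ε, h2, hε⟩ := (h1.and self_mem_nhdsWithin).exists
    obtain ⟨a, haA, ha⟩ := h hI.toFinset ε hε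
    refine ⟨a, hvt fun i hi => h2 i hi ?_, haA⟩
    rw [mem_ball_iff_norm']
    exact ha i (by simpa using hi)

namespace UnitaryRep

variable {Γ : Type u} [Group Γ]

/-- The cone of finite sums of diagonal coefficient functions of representations in `S`. -/
def coeffCone (S : Set (UnitaryRep Γ)) : AddSubmonoid (Γ → ℂ) :=
  AddSubmonoid.closure {φ | ∃ σ ∈ S, ∃ y : σ.space, σ.coeff y = φ}

lemma coeff_mem_coeffCone {S : Set (UnitaryRep Γ)} {σ : UnitaryRep Γ} (hσ : σ ∈ S) (y : σ.space) :
    σ.coeff y ∈ coeffCone S :=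
  AddSubmonoid.subset_closure ⟨σ, hσ, y, rfl⟩

lemma mem_coeffCone_iff {S : Set (UnitaryRep Γ)} {φ : Γ → ℂ} :
    φ ∈ coeffCone S ↔ ∃ (n : ℕ) (σ : Fin n → UnitaryRep Γ) (y : (i : Fin n) → (σ i).space),
      (∀ i, σ i ∈ S) ∧ φ = ∑ i, (σ i).coeff (y i) := by
  constructor
  · intro h
    -- Bundling each representation with its vector turns the dependent families into plain ones,
    -- which `Fin.append` can concatenate.
    suffices h' : ∃ (n : ℕ) (p : Fin n → Σ σ : UnitaryRep Γ, σ.space),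
        (∀ i, (p i).1 ∈ S) ∧ φ = ∑ i, (p i).1.coeff (p i).2 by
      obtain ⟨n, p, h1, h2⟩ := h'
      exact ⟨n, fun i => (p i).1, fun i => (p i).2, h1, h2⟩
    induction h using AddSubmonoid.closure_induction with
    | mem φ h =>
      obtain ⟨σ, hσ, y, rfl⟩ := h
      exact ⟨1, fun _ => ⟨σ, y⟩, fun _ => hσ, by simp⟩
    | zero => exact ⟨0, Fin.elim0, fun i => i.elim0, by simp⟩
    | add φ ψ _ _ h1 h2 =>
      obtain ⟨n, p, hp, rfl⟩ := h1
      obtain ⟨m, q, hq, rfl⟩ := h2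
      refine ⟨n + m, Fin.append p q, fun i => ?_, ?_⟩
      · refine Fin.addCases (fun i => ?_) (fun i => ?_) i
        · simpa using hp i
        · simpa using hq i
      · rw [Fin.sum_univ_add]
        congr 1 <;> refine Finset.sum_congr rfl fun i _ => ?_
        · rw [Fin.append_left]
        · rw [Fin.append_right]
  · rintro ⟨n, σ, y, hσ, rfl⟩
    exact sum_mem fun i _ => coeff_mem_coeffCone (hσ i) _

lemma weaklyContains_iff {S : Set (UnitaryRep Γ)} {π : UnitaryRep Γ} :
    WeaklyContains S π ↔ ∀ x, π.coeff x ∈ closure (coeffCone S : Set (Γ → ℂ)) := by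
  refine forall_congr' fun x => ?_
  rw [mem_closure_pi_iff_forall_finset]
  refine forall_congr' fun F => forall_congr' fun ε => forall_congr' fun _ => ⟨?_, ?_⟩
  · rintro ⟨n, σ, y, hσ, h⟩
    exact ⟨_, mem_coeffCone_iff.2 ⟨n, σ, y, hσ, rfl⟩, fun s hs => by simpa using h s hs⟩
  · rintro ⟨_, hφ, h⟩
    obtain ⟨n, σ, y, hσ, rfl⟩ := mem_coeffCone_iff.1 hφ
    exact ⟨n, σ, y, hσ, fun s hs => by simpa using h s hs⟩

/-! ### Simultaneous approximation of matrices of coefficients -/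

variable {ι : Type*}

/-- The matrix of coefficient functions of a family of vectors. -/
def gram (π : UnitaryRep Γ) (u : ι → π.space) (k l : ι) : Γ → ℂ := π.coeff₂ (u k) (u l)

variable (ι) in
/-- The cone of finite sums of matrices of coefficient functions of representations in `S`. -/
def gramCone (S : Set (UnitaryRep Γ)) : AddSubmonoid (ι → ι → Γ → ℂ) :=
  AddSubmonoid.closure {K | ∃ σ ∈ S, ∃ y : ι → σ.space, σ.gram y = K}

lemma gram_mem_gramCone {S : Set (UnitaryRep Γ)} {σ : UnitaryRep Γ} (hσ : σ ∈ S)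
    (y : ι → σ.space) : σ.gram y ∈ gramCone ι S :=
  AddSubmonoid.subset_closure ⟨σ, hσ, y, rfl⟩

lemma continuous_gram (π : UnitaryRep Γ) : Continuous (π.gram : (ι → π.space) → _) := by
  unfold gram coeff₂
  fun_prop

/-- For families of vectors `∑ c_k(g) π(g)w`, the matrix of coefficient functions in terms of the
coefficient function of `w`. -/
def cyclicGram (c : ι → Γ →₀ ℂ) : (Γ → ℂ) →+ (ι → ι → Γ → ℂ) where
  toFun φ k l s := ∑ g ∈ (c k).support, ∑ h ∈ (c l).support, c k g * star (c l h) * φ (h⁻¹ * s * g)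
  map_zero' := by ext; simp
  map_add' φ ψ := by ext; simp [mul_add, Finset.sum_add_distrib]

lemma continuous_cyclicGram (c : ι → Γ →₀ ℂ) : Continuous (cyclicGram c) := by
  change Continuous fun φ : Γ → ℂ => fun k l s =>
    ∑ g ∈ (c k).support, ∑ h ∈ (c l).support, c k g * star (c l h) * φ (h⁻¹ * s * g)
  fun_prop

lemma cyclicGram_coeff (π : UnitaryRep Γ) (c : ι → Γ →₀ ℂ) (w : π.space) :
    cyclicGram c (π.coeff w) = π.gram fun k => (c k).sum fun g a => a • π.op g w := by
  ext k l s
  simp only [cyclicGram, AddMonoidHom.coe_mk, ZeroHom.coe_mk, gram, coeff₂, Finsupp.sum, map_sum,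
    map_smul, sum_inner, inner_sum, inner_smul_left, inner_smul_right, inner_op_left, coeff,
    op_mul_apply]
  refine Finset.sum_congr rfl fun g _ => ?_
  rw [Finset.mul_sum]
  refine Finset.sum_congr rfl fun h _ => ?_
  rw [starRingEnd_apply]
  ring

/-- Weak containment approximates one diagonal coefficient at a time. For vectors in the orbit span
of a single `w`, the whole matrix is a continuous additive function of the coefficient of `w`, and
it takes coefficients of `σ` to matrices of `σ`. -/
lemma gram_cyclic_mem_closure {S : Set (UnitaryRep Γ)} {π : UnitaryRep Γ} {w : π.space}
    (h : π.coeff w ∈ closure (coeffCone S : Set (Γ → ℂ))) (c : ι → Γ →₀ ℂ) :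
    π.gram (fun k => (c k).sum fun g a => a • π.op g w) ∈
      closure (gramCone ι S : Set (ι → ι → Γ → ℂ)) := by
  rw [← cyclicGram_coeff]
  refine map_mem_closure (continuous_cyclicGram c) h fun φ hφ => ?_
  have : coeffCone S ≤ (gramCone ι S).comap (cyclicGram c) := by
    rw [coeffCone, AddSubmonoid.closure_le]
    rintro _ ⟨σ, hσ, y, rfl⟩
    change cyclicGram c (σ.coeff y) ∈ gramCone ι S
    rw [cyclicGram_coeff]
    exact gram_mem_gramCone hσ _
  exact this hφ

/-- The cyclic subspace generated by a vector. -/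
def cyclicSubspace (π : UnitaryRep Γ) (w : π.space) : Submodule ℂ π.space :=
  (Submodule.span ℂ (Set.range fun g => π.op g w)).topologicalClosure

instance (π : UnitaryRep Γ) (w : π.space) : CompleteSpace (π.cyclicSubspace w) :=
  (Submodule.isClosed_topologicalClosure _).completeSpace_coe

lemma self_mem_cyclicSubspace (π : UnitaryRep Γ) (w : π.space) : w ∈ π.cyclicSubspace w :=
  Submodule.le_topologicalClosure _ (Submodule.subset_span ⟨1, by simp⟩)

lemma op_mem_cyclicSubspace (π : UnitaryRep Γ) {w x : π.space} (s : Γ)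
    (hx : x ∈ π.cyclicSubspace w) : π.op s x ∈ π.cyclicSubspace w := by
  refine map_mem_closure (π.op s).continuous hx fun y hy => ?_
  induction hy using Submodule.span_induction with
  | mem y hy =>
    obtain ⟨g, rfl⟩ := hy
    exact Submodule.subset_span ⟨s * g, π.op_mul_apply s g w⟩
  | zero => simp
  | add x y _ _ hx hy => rw [map_add]; exact add_mem hx hy
  | smul a x _ hx => rw [map_smul]; exact Submodule.smul_mem _ _ hx

lemma gram_mem_closure_of_mem_cyclicSubspace {S : Set (UnitaryRep Γ)} {π : UnitaryRep Γ}
    {w : π.space} (h : π.coeff w ∈ closure (coeffCone S : Set (Γ → ℂ))) {u : ι → π.space}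
    (hu : ∀ k, u k ∈ π.cyclicSubspace w) :
    π.gram u ∈ closure (gramCone ι S : Set (ι → ι → Γ → ℂ)) := by
  have hu' : u ∈ closure (Set.univ.pi fun _ : ι =>
      (Submodule.span ℂ (Set.range fun g => π.op g w) : Set π.space)) := by
    rw [closure_pi_set]
    exact fun k _ => hu k
  rw [← closure_closure]
  refine map_mem_closure π.continuous_gram hu' fun v hv => ?_
  have hv' : ∀ k, ∃ c : Γ →₀ ℂ, (c.sum fun g a => a • π.op g w) = v k := fun k =>
    Finsupp.mem_span_range_iff_exists_finsupp.1 (hv k trivial)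
  choose c hc using hv'
  obtain rfl : (fun k => (c k).sum fun g a => a • π.op g w) = v := funext hc
  exact gram_cyclic_mem_closure h c

/-- The cyclic subspace and its orthogonal complement are both invariant, so all cross terms vanish.
-/
lemma gram_add_of_orthogonal {π : UnitaryRep Γ} {w : π.space} {a b : ι → π.space}
    (ha : ∀ k, a k ∈ π.cyclicSubspace w) (hb : ∀ k, b k ∈ (π.cyclicSubspace w)ᗮ) :
    π.gram (a + b) = π.gram a + π.gram b := by
  ext k l s
  have h1 : inner ℂ (b l) (π.op s (a k)) = 0 :=
    Submodule.inner_left_of_mem_orthogonal (π.op_mem_cyclicSubspace s (ha k)) (hb l)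
  have h2 : inner ℂ (a l) (π.op s (b k)) = 0 := by
    rw [← inv_inv s, ← inner_op_left]
    exact Submodule.inner_right_of_mem_orthogonal (π.op_mem_cyclicSubspace s⁻¹ (ha l)) (hb k)
  simp [gram, coeff₂, h1, h2]

/-- If `S` weakly contains `π`, then the matrices of coefficient functions of `π` are limits of sums
of those of representations in `S`. -/
theorem WeaklyContains.gram_mem_closure [Finite ι] {S : Set (UnitaryRep Γ)} {π : UnitaryRep Γ}
    (h : WeaklyContains S π) (u : ι → π.space) :
    π.gram u ∈ closure (gramCone ι S : Set (ι → ι → Γ → ℂ)) := by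
  classical
  have := Fintype.ofFinite ι
  -- Induction on a set containing the indices of the nonzero vectors: splitting off the cyclic
  -- subspace of `u j` leaves a remainder that vanishes at `j` and still vanishes wherever `u` did.
  suffices key : ∀ (t : Finset ι) (u : ι → π.space), (∀ k ∉ t, u k = 0) →
      π.gram u ∈ (gramCone ι S).topologicalClosure from key Finset.univ u (by simp)
  intro t
  induction t using Finset.induction_on with
  | empty =>
    intro u hu
    have : π.gram u = 0 := by ext k l s; simp [gram, coeff₂, hu k (by simp)]
    rw [this]
    exact zero_mem _
  | insert j t _ ih =>
    intro u hu
    set M := π.cyclicSubspace (u j)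
    have hj : M.starProjection (u j) = u j :=
      Submodule.starProjection_eq_self_iff.2 (π.self_mem_cyclicSubspace _)
    have hdecomp : u =
        (fun k => M.starProjection (u k)) + fun k => u k - M.starProjection (u k) := by
      ext k; simp
    rw [hdecomp, gram_add_of_orthogonal (w := u j) (fun k => Submodule.starProjection_apply_mem _ _)
      (fun k => Submodule.sub_starProjection_mem_orthogonal _)]
    refine add_mem (gram_mem_closure_of_mem_cyclicSubspace (weaklyContains_iff.1 h (u j))
      fun k => Submodule.starProjection_apply_mem _ _) (ih _ fun k hk => ?_)
    obtain rfl | hkj := eq_or_ne k j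
    · rw [hj, sub_self]
    · rw [hu k (by simp [hk, hkj]), map_zero, sub_zero]

/-- If the `D`-representations weakly contain `π`, they contain sums of products of coefficient
functions of `π` and of an arbitrary representation `τ`. -/
theorem sum_gram_mul_mem_closure [Fintype ι] {D : Ideal (lp (fun _ : Γ => ℂ) ∞)}
    {π : UnitaryRep Γ} (h : WeaklyContains (dReps D) π) (τ : UnitaryRep Γ) (u : ι → π.space)
    (v : ι → τ.space) : ∑ k, ∑ l, π.coeff₂ (u k) (u l) * τ.coeff₂ (v k) (v l) ∈
      closure (coeffCone (dReps D) : Set (Γ → ℂ)) := by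
  let Ψ : (ι → ι → Γ → ℂ) →+ (Γ → ℂ) :=
    { toFun := fun K => ∑ k, ∑ l, K k l * τ.coeff₂ (v k) (v l)
      map_zero' := by simp
      map_add' := fun K L => by simp [add_mul, Finset.sum_add_distrib] }
  have hΨ : Continuous Ψ := by
    change Continuous fun K : ι → ι → Γ → ℂ => ∑ k, ∑ l, K k l * τ.coeff₂ (v k) (v l)
    fun_prop
  refine map_mem_closure (f := Ψ) hΨ (h.gram_mem_closure u) fun K hK => ?_
  have : gramCone ι (dReps D) ≤ (coeffCone (dReps D)).comap Ψ := by
    refine AddSubmonoid.closure_le.2 ?_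
    rintro _ ⟨σ, hσ, y, rfl⟩
    -- On a generator of the cone, the double sum is the diagonal coefficient of `∑ y k ⊗ v k` in `σ
    -- ⊗ τ`.
    have := coeff_mem_coeffCone (S := dReps D) (IsDRep.tensor hσ τ)
      (σ.toTensor τ (∑ k, TensorProduct.tmul ℂ (y k) (v k)))
    rwa [coeff_toTensor_sum] at this
  exact this hK

end UnitaryRep

/-! ### From weak containment to seminorm bounds -/

namespace PreGroupCStar

open UnitaryRep

variable {Γ : Type u} [Group Γ]

/-- The linear functional on functions on `Γ` defined by an element of the group ring. -/
def pairing (a : MonoidAlgebra ℂ Γ) : (Γ → ℂ) →+ ℂ where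
  toFun φ := ∑ s ∈ a.coeff.support, a.coeff s * φ s
  map_zero' := by simp
  map_add' φ ψ := by simp [mul_add, Finset.sum_add_distrib]

omit [Group Γ] in
lemma continuous_pairing (a : MonoidAlgebra ℂ Γ) : Continuous (pairing a) := by
  change Continuous fun φ : Γ → ℂ => ∑ s ∈ a.coeff.support, a.coeff s * φ s
  fun_prop

lemma onGroupRing_eq_sum (π : UnitaryRep Γ) (a : MonoidAlgebra ℂ Γ) :
    π.onGroupRing a = ∑ s ∈ a.coeff.support, a.coeff s • π.op s := by
  simp [onGroupRing, MonoidAlgebra.lift_apply, op, Finsupp.sum]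

lemma pairing_coeff (π : UnitaryRep Γ) (a : MonoidAlgebra ℂ Γ) (x : π.space) :
    pairing a (π.coeff x) = inner ℂ x (π.onGroupRing a x) := by
  simp only [onGroupRing_eq_sum, pairing, coeff, sum_apply, inner_sum, AddMonoidHom.coe_mk,
    ZeroHom.coe_mk, smul_apply, inner_smul_right]

lemma re_pairing_star_mul_self {S : Set (UnitaryRep Γ)} (π : UnitaryRep Γ)
    (x : PreGroupCStar S) (z : π.space) :
    (pairing ((of S).symm (star x * x)) (π.coeff z)).re = ‖act π x z‖ ^ 2 := by
  rw [pairing_coeff]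
  change (inner ℂ z (act π (star x * x) z)).re = _
  rw [map_mul, act_star, ContinuousLinearMap.star_eq_adjoint, mul_apply_eq_comp,
    ContinuousLinearMap.adjoint_inner_right]
  exact inner_self_eq_norm_sq (𝕜 := ℂ) _

/-- A representation that is weakly contained in `S` is bounded by the seminorm of `S`. -/
theorem norm_act_le_of_weaklyContains {S : Set (UnitaryRep Γ)} {π : UnitaryRep Γ}
    (h : WeaklyContains S π) (x : PreGroupCStar S) : ‖act π x‖ ≤ ‖x‖ := by
  refine ContinuousLinearMap.opNorm_le_bound _ (norm_nonneg' x) fun z => ?_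
  refine le_of_sq_le_sq ?_ (mul_nonneg (norm_nonneg' x) (norm_nonneg z))
  -- For `φ = σ_{y,y}` this inequality reads `‖σ(x)y‖² ≤ ‖x‖²‖y‖²`. It is additive and closed in
  -- `φ`, so it passes to the closed cone.
  have key : closure (coeffCone S : Set (Γ → ℂ)) ⊆
      {φ | (pairing ((of S).symm (star x * x)) φ).re ≤ ‖x‖ ^ 2 * (φ 1).re} := by
    refine closure_minimal (fun φ hφ => ?_) (isClosed_le ?_ (by fun_prop))
    · induction hφ using AddSubmonoid.closure_induction with
      | mem φ hφ =>
        obtain ⟨σ, hσ, y, rfl⟩ := hφ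
        have h1 : (σ.coeff y 1).re = ‖y‖ ^ 2 := by
          simp only [coeff, op_one]
          exact inner_self_eq_norm_sq (𝕜 := ℂ) y
        rw [Set.mem_ofPred_eq, re_pairing_star_mul_self, h1, ← mul_pow]
        gcongr
        exact (act σ x).le_of_opNorm_le (norm_act_le hσ x) y
      | zero => simp
      | add φ ψ _ _ h1 h2 =>
        simp only [Set.mem_ofPred_eq, map_add, Complex.add_re, Pi.add_apply] at h1 h2 ⊢
        linarith
    · exact Complex.continuous_re.comp (continuous_pairing _)
  have := key (weaklyContains_iff.1 h z)
  rw [Set.mem_ofPred_eq, re_pairing_star_mul_self] at this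
  refine this.trans_eq ?_
  rw [mul_pow]
  congr 1
  simp only [coeff, op_one]
  exact inner_self_eq_norm_sq (𝕜 := ℂ) z

end PreGroupCStar

/-! ### The Powers–Størmer inequality for finite-rank operators -/

open InnerProductSpace

section PowersStormer

/-- The **Powers–Størmer inequality** `‖A - B‖₂² ≤ ‖A² - B²‖₁`, in finite dimensions. -/
theorem exists_re_trace_sub_mul_self_le {W : Type*} [NormedAddCommGroup W] [InnerProductSpace ℂ W]
    [FiniteDimensional ℂ W] {A B : W →ₗ[ℂ] W} (hA : A.IsPositive) (hB : B.IsPositive) :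
    ∃ U : W →ₗ[ℂ] W, (∀ v, ‖U v‖ ≤ ‖v‖) ∧
      0 ≤ (LinearMap.trace ℂ W ((A - B) * (A - B))).re ∧
      (LinearMap.trace ℂ W ((A - B) * (A - B))).re ≤
        (LinearMap.trace ℂ W (U * (A * A - B * B))).re := by
  have hC : (A - B).IsSymmetric := hA.isSymmetric.sub hB.isSymmetric
  set b := hC.eigenvectorBasis rfl
  set c := hC.eigenvalues rfl
  have hb : ∀ j, A (b j) - B (b j) = (c j : ℂ) • b j := fun j => hC.apply_eigenvectorBasis rfl j
  let sgn : ℝ → ℝ := fun r => if 0 ≤ r then 1 else -1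
  have hsgn : ∀ r, ‖(sgn r : ℂ)‖ = 1 := fun r => by
    by_cases h : 0 ≤ r <;> simp [sgn, h]
  -- `U` is the sign of `A - B`, diagonal in its eigenbasis; the value 1 at zero keeps it isometric.
  let U : W →ₗ[ℂ] W := b.toBasis.constr ℂ fun j => (sgn (c j) : ℂ) • b j
  have hU : ∀ j, U (b j) = (sgn (c j) : ℂ) • b j := fun j => by
    have := b.toBasis.constr_basis ℂ (fun j => (sgn (c j) : ℂ) • b j) j
    rwa [b.coe_toBasis] at this
  have h1 : ∀ j, inner ℂ (b j) (((A - B) * (A - B)) (b j)) = (c j : ℂ) * c j := fun j => by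
    rw [Module.End.mul_apply, LinearMap.sub_apply A B (b j), hb, map_smul, LinearMap.sub_apply,
      hb, inner_smul_right, inner_smul_right]
    simp [inner_self_eq_norm_sq_to_K]
  refine ⟨U, fun v => ?_, ?_, ?_⟩
  · have hv : U v = ∑ j, ((sgn (c j) : ℂ) * b.repr v j) • b j := by
      conv_lhs => rw [← b.sum_repr v, map_sum]
      exact Finset.sum_congr rfl fun j _ => by rw [map_smul, hU, smul_smul, mul_comm]
    refine le_of_sq_le_sq ?_ (norm_nonneg v)
    rw [← b.sum_sq_norm_inner_right v, ← b.sum_sq_norm_inner_right (U v)]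
    refine (Finset.sum_congr rfl fun j _ => ?_).le
    rw [hv, b.orthonormal.inner_right_fintype, norm_mul, hsgn, one_mul, b.repr_apply_apply]
  · rw [LinearMap.trace_eq_sum_inner _ b, Complex.re_sum]
    refine Finset.sum_nonneg fun j _ => ?_
    rw [h1, ← Complex.ofReal_mul, Complex.ofReal_re]
    exact mul_self_nonneg _
  · rw [LinearMap.trace_mul_comm ℂ U, LinearMap.trace_eq_sum_inner _ b,
      LinearMap.trace_eq_sum_inner _ b, Complex.re_sum, Complex.re_sum]
    refine Finset.sum_le_sum fun j _ => ?_
    have hAj : 0 ≤ (inner ℂ (b j) (A (b j))).re := hA.re_inner_nonneg_right (b j)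
    have hBj : 0 ≤ (inner ℂ (b j) (B (b j))).re := hB.re_inner_nonneg_right (b j)
    have hdiff : (inner ℂ (b j) (A (b j))).re - (inner ℂ (b j) (B (b j))).re = c j := by
      rw [← Complex.sub_re, ← inner_sub_right, hb, inner_smul_right]
      simp [inner_self_eq_norm_sq_to_K]
    have h2 : inner ℂ (b j) (((A * A - B * B) * U) (b j)) =
        (sgn (c j) : ℂ) * (c j * (inner ℂ (b j) (A (b j)) + inner ℂ (b j) (B (b j)))) := by
      -- With `C = A - B`, this is `A² - B² = AC + CB`, where both `C` produce the eigenvalue `c j`.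
      have h3 : A (A (b j)) - B (B (b j)) = A (A (b j) - B (b j)) + (A - B) (B (b j)) := by
        simp
      rw [Module.End.mul_apply, hU, map_smul, inner_smul_right, LinearMap.sub_apply,
        Module.End.mul_apply, Module.End.mul_apply, h3, hb, map_smul, inner_add_right,
        ← hC, LinearMap.sub_apply, hb, inner_smul_left, inner_smul_right, Complex.conj_ofReal]
      ring
    rw [h1 j, h2, ← Complex.ofReal_mul, Complex.ofReal_re, Complex.re_ofReal_mul,
      Complex.re_ofReal_mul, Complex.add_re]
    -- With `p = ⟨b j, A (b j)⟩` and `q = ⟨b j, B (b j)⟩` nonnegative and `c j = p - q`, the claim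
    -- is `|p - q|² ≤ |p - q|(p + q)`.
    rcases le_or_gt 0 (c j) with h | h
    · simp only [sgn, if_pos h]
      nlinarith
    · simp only [sgn, if_neg h.not_ge]
      nlinarith

variable {H : Type*} [NormedAddCommGroup H] [InnerProductSpace ℂ H]

/-- The positive operator `∑ |u_i⟩⟨u_i|`. -/
def sumRankOne {ι : Type*} [Fintype ι] (u : ι → H) : H →L[ℂ] H := ∑ i, rankOne ℂ (u i) (u i)

lemma sumRankOne_apply {ι : Type*} [Fintype ι] (u : ι → H) (z : H) :
    sumRankOne u z = ∑ i, inner ℂ (u i) z • u i := by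
  simp [sumRankOne]

lemma isPositive_sumRankOne {ι : Type*} [Fintype ι] (u : ι → H) : (sumRankOne u).IsPositive := by
  unfold sumRankOne
  exact ContinuousLinearMap.isPositive_sum _ fun i _ => isPositive_rankOne_self _

lemma subtypeL_comp_sumRankOne {ι : Type*} [Fintype ι] {W : Submodule ℂ H} (u : ι → W) (z : W) :
    (sumRankOne u z : H) = sumRankOne (fun i => (u i : H)) z := by
  simp [sumRankOne_apply]

lemma trace_mul_sumRankOne [FiniteDimensional ℂ H] {ι : Type*} [Fintype ι] (T : H →ₗ[ℂ] H)
    (u : ι → H) : LinearMap.trace ℂ H (T * (sumRankOne u).toLinearMap) =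
      ∑ i, inner ℂ (u i) (T (u i)) := by
  have : T * (sumRankOne u).toLinearMap =
      ∑ i, (rankOne ℂ (T (u i)) (u i)).toLinearMap := by
    ext z
    simp [sumRankOne_apply]
  rw [this, map_sum]
  simp_rw [trace_rankOne]

lemma trace_sumRankOne [FiniteDimensional ℂ H] {ι : Type*} [Fintype ι] (u : ι → H) :
    LinearMap.trace ℂ H (sumRankOne u).toLinearMap = ∑ i, inner ℂ (u i) (u i) := by
  simpa using trace_mul_sumRankOne 1 u

variable {ι κ : Type*} [Fintype ι] [Fintype κ]

/-- The Powers–Størmer inequality for square roots of the operators `∑ |x_i⟩⟨x_i|`. -/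
theorem exists_re_sum_inner_le_of_finiteDimensional [FiniteDimensional ℂ H] {x x' : ι → H}
    {u u' : κ → H}
    (h : ∀ z, sumRankOne u (sumRankOne u z) = sumRankOne x z)
    (h' : ∀ z, sumRankOne u' (sumRankOne u' z) = sumRankOne x' z) :
    ∃ U : H →ₗ[ℂ] H, (∀ v, ‖U v‖ ≤ ‖v‖) ∧
      0 ≤ ∑ i, ‖x' i‖ ^ 2 + ∑ i, ‖x i‖ ^ 2 - 2 * ∑ k, ∑ l, ‖inner ℂ (u l) (u' k)‖ ^ 2 ∧
      ∑ i, ‖x' i‖ ^ 2 + ∑ i, ‖x i‖ ^ 2 - 2 * ∑ k, ∑ l, ‖inner ℂ (u l) (u' k)‖ ^ 2 ≤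
        (∑ i, inner ℂ (x' i) (U (x' i)) - ∑ i, inner ℂ (x i) (U (x i))).re := by
  obtain ⟨U, hU, h0, hle⟩ := exists_re_trace_sub_mul_self_le
    (isPositive_sumRankOne u').toLinearMap (isPositive_sumRankOne u).toLinearMap
  refine ⟨U, hU, ?_⟩
  have e : (sumRankOne u).toLinearMap * (sumRankOne u).toLinearMap = (sumRankOne x).toLinearMap :=
    LinearMap.ext h
  have e' : (sumRankOne u').toLinearMap * (sumRankOne u').toLinearMap =
    (sumRankOne x').toLinearMap := LinearMap.ext h'
  have h1 : LinearMap.trace ℂ H ((sumRankOne u).toLinearMap * (sumRankOne u').toLinearMap) =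
      ((∑ k, ∑ l, ‖inner ℂ (u l) (u' k)‖ ^ 2 : ℝ) : ℂ) := by
    rw [trace_mul_sumRankOne]
    push_cast
    refine Finset.sum_congr rfl fun k _ => ?_
    simp only [sumRankOne_apply, inner_sum, inner_smul_right]
    refine Finset.sum_congr rfl fun l _ => ?_
    rw [← Complex.mul_conj', inner_conj_symm]
  have h2 : ∀ y : ι → H, (∑ i, inner ℂ (y i) (y i) : ℂ) = ((∑ i, ‖y i‖ ^ 2 : ℝ) : ℂ) := fun y => by
    push_cast
    exact Finset.sum_congr rfl fun i _ => inner_self_eq_norm_sq_to_K _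
  rw [sub_mul, mul_sub, mul_sub, e, e', mul_sub U, map_sub, map_sub, map_sub, map_sub,
    LinearMap.trace_mul_comm ℂ (sumRankOne u').toLinearMap, h1, trace_sumRankOne, trace_sumRankOne,
    trace_mul_sumRankOne, trace_mul_sumRankOne, h2, h2] at hle
  rw [sub_mul, mul_sub, mul_sub, e, e', map_sub, map_sub, map_sub,
    LinearMap.trace_mul_comm ℂ (sumRankOne u').toLinearMap, h1, trace_sumRankOne, trace_sumRankOne,
    h2, h2] at h0
  simp only [Complex.sub_re, Complex.ofReal_re] at h0 hle ⊢
  constructor <;> linarith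

/-- Every vector lies in a finite-dimensional subspace, where the previous case applies; the
contraction found there is extended by zero on the orthogonal complement. -/
theorem exists_re_sum_inner_le {x x' : ι → H} {u u' : κ → H}
    (h : ∀ z, sumRankOne u (sumRankOne u z) = sumRankOne x z)
    (h' : ∀ z, sumRankOne u' (sumRankOne u' z) = sumRankOne x' z) :
    ∃ U : H →L[ℂ] H, ‖U‖ ≤ 1 ∧
      0 ≤ ∑ i, ‖x' i‖ ^ 2 + ∑ i, ‖x i‖ ^ 2 - 2 * ∑ k, ∑ l, ‖inner ℂ (u l) (u' k)‖ ^ 2 ∧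
      ∑ i, ‖x' i‖ ^ 2 + ∑ i, ‖x i‖ ^ 2 - 2 * ∑ k, ∑ l, ‖inner ℂ (u l) (u' k)‖ ^ 2 ≤
        (∑ i, inner ℂ (x' i) (U (x' i)) - ∑ i, inner ℂ (x i) (U (x i))).re := by
  let W : Submodule ℂ H := Submodule.span ℂ
    ((Set.range x ∪ Set.range x') ∪ (Set.range u ∪ Set.range u'))
  have : FiniteDimensional ℂ W := FiniteDimensional.span_of_finite ℂ
    (((Set.finite_range _).union (Set.finite_range _)).union
      ((Set.finite_range _).union (Set.finite_range _)))
  let y : ι → W := fun i => ⟨x i, Submodule.subset_span (.inl (.inl ⟨i, rfl⟩))⟩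
  let y' : ι → W := fun i => ⟨x' i, Submodule.subset_span (.inl (.inr ⟨i, rfl⟩))⟩
  let v : κ → W := fun i => ⟨u i, Submodule.subset_span (.inr (.inl ⟨i, rfl⟩))⟩
  let v' : κ → W := fun i => ⟨u' i, Submodule.subset_span (.inr (.inr ⟨i, rfl⟩))⟩
  obtain ⟨U, hU, h0, hle⟩ := exists_re_sum_inner_le_of_finiteDimensional (x := y) (x' := y')
    (u := v) (u' := v') (fun z => Subtype.ext (by simpa only [subtypeL_comp_sumRankOne] using h z))
    (fun z => Subtype.ext (by simpa only [subtypeL_comp_sumRankOne] using h' z))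
  refine ⟨W.subtypeL ∘L U.toContinuousLinearMap ∘L W.orthogonalProjectionOnto, ?_, h0, ?_⟩
  · refine ContinuousLinearMap.opNorm_le_bound _ zero_le_one fun z => ?_
    rw [one_mul]
    exact (hU _).trans (W.norm_orthogonalProjectionOnto_apply_le z)
  · have key : ∀ w : W, inner ℂ (w : H) ((W.subtypeL ∘L U.toContinuousLinearMap ∘L
        W.orthogonalProjectionOnto) w) = inner ℂ w (U w) := fun w => by
      simp
    have k1 := fun i => key (y i)
    have k2 := fun i => key (y' i)
    simp only [y, y'] at k1 k2
    simp_rw [k1, k2]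
    exact hle

/-- Every operator `∑ |x_i⟩⟨x_i|` has a square root of the same form. -/
theorem exists_sumRankOne_sq_eq (x : ι → H) : ∃ (n : ℕ) (u : Fin n → H),
    ∀ z, sumRankOne u (sumRankOne u z) = sumRankOne x z := by
  let W : Submodule ℂ H := Submodule.span ℂ (Set.range x)
  have : FiniteDimensional ℂ W := FiniteDimensional.span_of_finite ℂ (Set.finite_range _)
  let y : ι → W := fun i => ⟨x i, Submodule.subset_span ⟨i, rfl⟩⟩
  have hS : 0 ≤ sumRankOne y :=
    (ContinuousLinearMap.nonneg_iff_isPositive _).2 (isPositive_sumRankOne y)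
  -- The root is taken on the finite-dimensional span `W`, where a positive operator is again a
  -- finite sum of rank-one ones.
  obtain ⟨n, v, hv⟩ := ContinuousLinearMap.isPositive_iff_eq_sum_rankOne.1
    ((ContinuousLinearMap.nonneg_iff_isPositive _).1 (CFC.sqrt_nonneg (sumRankOne y)))
  have hsq := CFC.sqrt_mul_sqrt_self (sumRankOne y) hS
  change CFC.sqrt (sumRankOne y) = sumRankOne v at hv
  rw [hv] at hsq
  refine ⟨n, fun i => v i, fun z => ?_⟩
  have hproj : ∀ {m : ℕ} (w : Fin m → W), sumRankOne (fun i => (w i : H)) z =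
      sumRankOne w (W.orthogonalProjectionOnto z) := fun w => by
    simp [sumRankOne_apply]
  have hprojx : sumRankOne x z = sumRankOne y (W.orthogonalProjectionOnto z) := by
    have : ∀ i, inner ℂ (x i) z = inner ℂ (y i) (W.orthogonalProjectionOnto z) := fun i => by
      simp [y]
    simp_rw [sumRankOne_apply, this]
    simp [y]
  rw [hproj, hprojx, ← hsq, ← subtypeL_comp_sumRankOne]
  rfl

end PowersStormer

/-! ### Vector functionals on bounded operators -/

section VectorFunctional

variable {H : Type*} [NormedAddCommGroup H] [InnerProductSpace ℂ H]

/-- The functional `T ↦ ⟨x, T y⟩` on bounded operators. -/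
def vectorFunctional (x y : H) : (H →L[ℂ] H) →L[ℂ] ℂ :=
  innerSL ℂ x ∘L ContinuousLinearMap.apply ℂ H y

@[simp]
lemma vectorFunctional_apply (x y : H) (T : H →L[ℂ] H) :
    vectorFunctional x y T = inner ℂ x (T y) := rfl

lemma norm_vectorFunctional_le (x y : H) : ‖vectorFunctional x y‖ ≤ ‖x‖ * ‖y‖ := by
  refine ContinuousLinearMap.opNorm_le_bound _ (by positivity) fun T => ?_
  calc ‖inner ℂ x (T y)‖ ≤ ‖x‖ * ‖T y‖ := norm_inner_le_norm _ _
    _ ≤ ‖x‖ * (‖T‖ * ‖y‖) := by gcongr; exact T.le_opNorm y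
    _ = _ := by ring

/-- Functionals on the span of the vector functionals come from bounded operators. -/
lemma exists_forall_vectorFunctional_eq [CompleteSpace H] (f : ((H →L[ℂ] H) →L[ℂ] ℂ) →L[ℂ] ℂ) :
    ∃ T : H →L[ℂ] H, ∀ x y, f (vectorFunctional x y) = inner ℂ x (T y) := by
  -- The map `(x, y) ↦ f (vectorFunctional x y)` is a bounded sesquilinear form, hence given by an
  -- operator.
  let B : H →L⋆[ℂ] H →L[ℂ] ℂ := LinearMap.mkContinuous₂
    (LinearMap.mk₂'ₛₗ (starRingEnd ℂ) (RingHom.id ℂ) (fun x y => f (vectorFunctional x y))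
      (fun x x' y => by
        rw [← map_add]; congr 1; ext T; simp)
      (fun c x y => by
        rw [← map_smul]; congr 1; ext T; simp [mul_comm])
      (fun x y y' => by
        rw [← map_add]; congr 1; ext T; simp)
      (fun c x y => by
        rw [RingHom.id_apply, ← map_smul]; congr 1; ext T; simp))
    ‖f‖ fun x y => by
      rw [mul_assoc]
      exact (f.le_opNorm _).trans
        (mul_le_mul_of_nonneg_left (norm_vectorFunctional_le x y) (norm_nonneg f))
  refine ⟨(InnerProductSpace.continuousLinearMapOfBilin B).adjoint, fun x y => ?_⟩
  rw [ContinuousLinearMap.adjoint_inner_right,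
    InnerProductSpace.continuousLinearMapOfBilin_apply]
  rfl

end VectorFunctional

/-! ### Amenability, almost invariant states and Hilbert–Schmidt vectors -/

namespace UnitaryRep

variable {Γ : Type u} [Group Γ]

/-- If `π` is amenable, no operator of the form `∑ (π(s)⋆ T_s π(s) - T_s)` has numerical range
bounded below by a positive number. -/
lemma IsAmenable.exists_re_inner_lt {π : UnitaryRep Γ} (hπ : π.IsAmenable) (F : Finset Γ)
    (T : F → π.space →L[ℂ] π.space) {c : ℝ} (hc : 0 < c) :
    ∃ x : π.space, ‖x‖ = 1 ∧
      (∑ s : F, (inner ℂ (π.op s x) (T s (π.op s x)) - inner ℂ x (T s x))).re < c := by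
  obtain ⟨μ, hμ1, hμ⟩ := hπ
  by_contra! hcon
  let Q : (F → π.space →L[ℂ] π.space) → π.space →L[ℂ] π.space := fun T =>
    ∑ s : F, (π.op (s : Γ)⁻¹ * T s * π.op s - T s)
  have hQμ : ∀ T, μ (Q T) = 0 := fun T => by
    simp only [Q, map_sum, map_sub]
    refine Finset.sum_eq_zero fun s _ => ?_
    have := hμ (s : Γ)⁻¹ (T s)
    rw [inv_inv] at this
    rw [this, sub_self]
  have hQstar : star (Q T) = Q fun s => star (T s) := by
    simp only [Q, star_sum, star_sub, star_mul, star_op, inv_inv, mul_assoc]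
  have hQinner : ∀ x, inner ℂ x (Q T x) =
      ∑ s : F, (inner ℂ (π.op s x) (T s (π.op s x)) - inner ℂ x (T s x)) := fun x => by
    simp only [Q, sum_apply, inner_sum, sub_apply, inner_sub_right, mul_apply_eq_comp,
      inner_op_left]
  have hQge : ∀ x, c * ‖x‖ ^ 2 ≤ (inner ℂ x (Q T x)).re := fun x => by
    obtain rfl | hx := eq_or_ne x 0
    · simp
    have hx' : ‖x‖ ≠ 0 := norm_ne_zero_iff.2 hx
    have h1 := hcon (((‖x‖⁻¹ : ℝ) : ℂ) • x) (by rw [norm_smul]; simp [hx'])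
    rw [← hQinner, map_smul, inner_smul_left, inner_smul_right, Complex.conj_ofReal, ← mul_assoc,
      ← Complex.ofReal_mul, Complex.re_ofReal_mul, ← mul_inv, ← sq,
      le_inv_mul_iff₀ (by positivity)] at h1
    linarith
  -- `Q T` need not be self-adjoint, so its bound on real parts becomes an operator inequality only
  -- after symmetrizing. The invariant state kills both `Q T` and its adjoint, which would give `0 ≤
  -- -2c`.
  have hpos : 0 ≤ Q T + star (Q T) - ((2 * c : ℝ) : ℂ) • (1 : π.space →L[ℂ] π.space) := by
    rw [ContinuousLinearMap.nonneg_iff_isPositive, ContinuousLinearMap.isPositive_def']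
    refine ⟨?_, fun x => ?_⟩
    · rw [isSelfAdjoint_iff, star_sub, star_add, star_star, star_smul, star_one, add_comm]
      simp
    · rw [ContinuousLinearMap.reApplyInnerSelf_apply, sub_apply, add_apply, inner_sub_left,
        inner_add_left, ContinuousLinearMap.star_eq_adjoint,
        ContinuousLinearMap.adjoint_inner_left, ← inner_conj_symm x, smul_apply, inner_smul_left,
        one_apply_eq_self]
      have h2 := hQge x
      have h3 : (inner ℂ (Q T x) x).re = (inner ℂ x (Q T x)).re := inner_re_symm (𝕜 := ℂ) _ _
      have h4 : (inner ℂ x x).re = ‖x‖ ^ 2 := inner_self_eq_norm_sq (𝕜 := ℂ) x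
      simp only [map_sub, map_add, RCLike.re_to_complex, Complex.conj_re, Complex.conj_ofReal,
        Complex.re_ofReal_mul, h3, h4]
      linarith
  have h5 := PositiveLinearMap.map_nonneg μ hpos
  rw [map_sub, map_add, hQstar, hQμ, hQμ, map_smul, hμ1] at h5
  have h6 := (Complex.le_def.1 h5).1
  simp at h6
  linarith

/-- If `π` is amenable, then there are normal states that are almost invariant in norm. -/
theorem IsAmenable.exists_norm_sub_lt {π : UnitaryRep Γ} (hπ : π.IsAmenable) (F : Finset Γ)
    {ε : ℝ} (hε : 0 < ε) : ∃ (ι : Type) (_ : Fintype ι) (x : ι → π.space),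
      ∑ i, ‖x i‖ ^ 2 = 1 ∧ ∀ s ∈ F, ‖∑ i, vectorFunctional (π.op s (x i)) (π.op s (x i)) -
        ∑ i, vectorFunctional (x i) (x i)‖ < ε := by
  classical
  let E := F → (π.space →L[ℂ] π.space) →L[ℂ] ℂ
  let v : π.space → E := fun x s =>
    vectorFunctional (π.op s x) (π.op s x) - vectorFunctional x x
  -- Day's trick: if 0 were separated in norm from the convex hull, the separating functional would
  -- be given on vector functionals by operators `T s`, contradicting amenability. Using the product
  -- over `F` handles all `s ∈ F` at once.
  have hmem : (0 : E) ∈ closure (convexHull ℝ (v '' Metric.sphere 0 1)) := by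
    by_contra h0
    obtain ⟨f, c, hc, hf⟩ := RCLike.geometric_hahn_banach_point_closed (𝕜 := ℂ)
      (convex_convexHull ℝ (v '' Metric.sphere 0 1)).closure isClosed_closure h0
    have hT : ∀ s : F, ∃ T : π.space →L[ℂ] π.space, ∀ x y,
        f (Pi.single s (vectorFunctional x y)) = inner ℂ x (T y) := fun s =>
      exists_forall_vectorFunctional_eq (f ∘L ContinuousLinearMap.single ℂ
        (fun _ : F => (π.space →L[ℂ] π.space) →L[ℂ] ℂ) s)
    choose T hT using hT
    rw [map_zero, map_zero] at hc
    obtain ⟨x, hx, hlt⟩ := hπ.exists_re_inner_lt F T hc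
    have h1 := hf (v x) (subset_closure (subset_convexHull _ _ ⟨x, by simpa using hx, rfl⟩))
    have h2 : f (v x) = ∑ s : F, (inner ℂ (π.op s x) (T s (π.op s x)) - inner ℂ x (T s x)) := by
      conv_lhs => rw [← Finset.univ_sum_single (v x), map_sum]
      refine Finset.sum_congr rfl fun s _ => ?_
      rw [← hT, ← hT, ← map_sub, ← Pi.single_sub]
    rw [h2] at h1
    exact lt_asymm h1 hlt
  obtain ⟨g, hg, hlt⟩ := Metric.mem_closure_iff.1 hmem ε hε
  obtain ⟨ι, hι, w, z, hw, hw1, hz, rfl⟩ := mem_convexHull_iff_exists_fintype.1 hg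
  choose y hy hyz using hz
  -- Convex weights are absorbed into the vectors through their square roots, vector functionals
  -- being quadratic.
  refine ⟨ι, hι, fun i => ((√(w i) : ℝ) : ℂ) • y i, ?_, fun s hs => ?_⟩
  · rw [← hw1]
    refine Finset.sum_congr rfl fun i _ => ?_
    have : ‖y i‖ = 1 := by simpa using hy i
    rw [norm_smul, this, mul_one, Complex.norm_real, Real.norm_eq_abs, sq_abs, Real.sq_sqrt (hw i)]
  · rw [dist_zero_left] at hlt
    refine lt_of_eq_of_lt ?_ ((norm_le_pi_norm _ (⟨s, hs⟩ : F)).trans_lt hlt)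
    rw [← Finset.sum_sub_distrib, Finset.sum_apply]
    congr 1
    refine Finset.sum_congr rfl fun i _ => ?_
    rw [Pi.smul_apply, ← hyz]
    have hsc : ∀ (a : ℝ) (x : π.space), vectorFunctional ((a : ℂ) • x) ((a : ℂ) • x) =
        (a ^ 2) • vectorFunctional x x := fun a x => by
      ext T
      simp [sq, mul_assoc]
    rw [map_smul, hsc, hsc, Real.sq_sqrt (hw i)]
    exact (smul_sub _ _ _).symm

lemma sumRankOne_op {ι : Type*} [Fintype ι] (π : UnitaryRep Γ) (s : Γ) (x : ι → π.space)
    (z : π.space) : sumRankOne (fun i => π.op s (x i)) z = π.op s (sumRankOne x (π.op s⁻¹ z)) := by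
  simp [sumRankOne_apply, inner_op_left]

/-- If `π` is amenable, then the trivial representation is weakly contained in the tensor product of
`π` and its conjugate. -/
theorem IsAmenable.one_mem_closure {π : UnitaryRep Γ} (hπ : π.IsAmenable) :
    (1 : Γ → ℂ) ∈ closure {φ | ∃ (n : ℕ) (u : Fin n → π.space),
      φ = ∑ k, ∑ l, π.coeff₂ (u k) (u l) * star (π.coeff₂ (u k) (u l))} := by
  rw [mem_closure_pi_iff_forall_finset]
  intro F ε hε
  obtain ⟨ι, _, x, hx1, hx⟩ := hπ.exists_norm_sub_lt F hε
  -- The density operator `∑ |x_i⟩⟨x_i|` has trace 1, so its root `∑ |u_k⟩⟨u_k|` is a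
  -- Hilbert–Schmidt unit vector, corresponding to `∑ u_k ⊗ ū_k`.
  obtain ⟨n, u, hu⟩ := exists_sumRankOne_sq_eq x
  refine ⟨_, ⟨n, u, rfl⟩, fun s hs => ?_⟩
  -- Conjugation by `π(s)` commutes with taking roots. The middle quantity is then `2(1 - φ(s))`,
  -- where `φ` is the coefficient of that unit vector; it is nonnegative and less than `ε`.
  obtain ⟨U, hU, h0, hle⟩ := exists_re_sum_inner_le (x := x) (x' := fun i => π.op s (x i)) (u := u)
    (u' := fun i => π.op s (u i)) hu fun z => by
      rw [sumRankOne_op, sumRankOne_op, sumRankOne_op, ← hu, ← op_mul_apply]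
      simp
  simp only [norm_op_apply, hx1] at h0 hle
  have h1 : (∑ i, inner ℂ (π.op s (x i)) (U (π.op s (x i))) - ∑ i, inner ℂ (x i) (U (x i))).re
      < ε := by
    refine lt_of_le_of_lt ((Complex.re_le_norm _).trans ?_) (hx s hs)
    refine le_trans (le_of_eq ?_) ((ContinuousLinearMap.le_opNorm _ U).trans
      (mul_le_of_le_one_right (norm_nonneg _) hU))
    simp
  have h2 : (∑ k, ∑ l, π.coeff₂ (u k) (u l) * star (π.coeff₂ (u k) (u l))) s =
      ((∑ k, ∑ l, ‖inner ℂ (u l) (π.op s (u k))‖ ^ 2 : ℝ) : ℂ) := by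
    push_cast
    simp only [Finset.sum_apply, Pi.mul_apply, Pi.star_apply, coeff₂]
    refine Finset.sum_congr rfl fun k _ => Finset.sum_congr rfl fun l _ => ?_
    exact Complex.mul_conj' _
  rw [h2, Pi.one_apply, ← Complex.ofReal_one, ← Complex.ofReal_sub, Complex.norm_real,
    Real.norm_eq_abs, abs_of_nonneg (by linarith)]
  linarith

/-- If the `D`-representations weakly contain an amenable representation, then they weakly contain
every representation. -/
theorem weaklyContains_of_isAmenable {D : Ideal (lp (fun _ : Γ => ℂ) ∞)} {π : UnitaryRep Γ}
    (hπ : π.IsAmenable) (h : WeaklyContains (dReps D) π) (ρ : UnitaryRep Γ) :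
    WeaklyContains (dReps D) ρ := by
  rw [weaklyContains_iff]
  intro z
  have h1 : (1 : Γ → ℂ) * ρ.coeff z ∈ closure (closure (coeffCone (dReps D) : Set (Γ → ℂ))) := by
    refine map_mem_closure (f := fun φ : Γ → ℂ => φ * ρ.coeff z) (by fun_prop)
      hπ.one_mem_closure ?_
    rintro _ ⟨n, u, rfl⟩
    -- The factor `star (π.coeff₂ (u k) (u l)) * ρ.coeff z` is a coefficient of `π̄ ⊗ ρ`.
    convert sum_gram_mul_mem_closure h (π.conj.tensor ρ) u
      (fun k => π.conj.toTensor ρ (TensorProduct.tmul ℂ (π.toConj (u k)) z)) using 1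
    simp only [Finset.sum_mul, coeff₂_toTensor, coeff₂_toConj, coeff_eq_coeff₂, mul_assoc]
  rwa [one_mul, closure_closure] at h1

end UnitaryRep

/-! ### From seminorm bounds to weak containment -/

lemma norm_algebraMap_sub_le {A : Type*} [CStarAlgebra A] [PartialOrder A] [StarOrderedRing A]
    {b : A} (hb : 0 ≤ b) {c : ℝ} (hc : ‖b‖ ≤ c) : ‖algebraMap ℝ A c - b‖ ≤ c := by
  have hc0 : 0 ≤ c := (norm_nonneg b).trans hc
  have h1 : 0 ≤ algebraMap ℝ A c - b :=
    sub_nonneg.2 ((CStarAlgebra.norm_le_iff_le_algebraMap b hc0 hb).1 hc)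
  rw [CStarAlgebra.norm_le_iff_le_algebraMap _ hc0 h1]
  exact sub_le_self _ hb

namespace UnitaryRep

variable {Γ : Type u} [Group Γ]

lemma coeff_smul (π : UnitaryRep Γ) (t : ℝ) (x : π.space) :
    π.coeff ((t : ℂ) • x) = (t ^ 2) • π.coeff x := by
  ext s
  simp [coeff, sq, mul_assoc]

lemma smul_mem_coeffCone {S : Set (UnitaryRep Γ)} {r : ℝ} (hr : 0 ≤ r) {φ : Γ → ℂ}
    (hφ : φ ∈ coeffCone S) : r • φ ∈ coeffCone S := by
  induction hφ using AddSubmonoid.closure_induction with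
  | mem φ h =>
    obtain ⟨σ, hσ, y, rfl⟩ := h
    rw [← Real.sq_sqrt hr, ← coeff_smul]
    exact coeff_mem_coeffCone hσ _
  | zero => rw [smul_zero]; exact zero_mem _
  | add φ ψ _ _ h1 h2 => rw [smul_add]; exact add_mem h1 h2

lemma convex_coeffCone (S : Set (UnitaryRep Γ)) : Convex ℝ (coeffCone S : Set (Γ → ℂ)) :=
  fun _ hφ _ hψ _ _ ha hb _ =>
    add_mem (smul_mem_coeffCone ha hφ) (smul_mem_coeffCone hb hψ)

/-- If `π` is not weakly contained in `S`, then this is witnessed by an element of the group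
ring. -/
lemma exists_re_inner_neg_of_not_weaklyContains {S : Set (UnitaryRep Γ)} {π : UnitaryRep Γ}
    (h : ¬ WeaklyContains S π) : ∃ (a : MonoidAlgebra ℂ Γ) (x : π.space),
      (inner ℂ x (π.onGroupRing a x)).re < 0 ∧
        ∀ σ ∈ S, ∀ y : σ.space, 0 ≤ (inner ℂ y (σ.onGroupRing a y)).re := by
  classical
  unfold WeaklyContains at h
  push Not at h
  obtain ⟨x, F, ε, hε, h⟩ := h
  -- After restriction to `F`, a linear functional has finitely many coordinates and is therefore an
  -- element of the group ring supported on `F`.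
  let r : (Γ → ℂ) →ₗ[ℝ] (F → ℂ) := LinearMap.funLeft ℝ ℂ ((↑) : F → Γ)
  have hx : r (π.coeff x) ∉ closure (r '' coeffCone S) := fun hmem => by
    obtain ⟨_, ⟨φ, hφ, rfl⟩, hlt⟩ := mem_closure_pi_iff_forall_finset.1 hmem Finset.univ ε hε
    obtain ⟨n, σ, y, hσ, rfl⟩ := mem_coeffCone_iff.1 hφ
    obtain ⟨s, hs, hle⟩ := h n σ y hσ
    refine hle.not_gt ?_
    have := hlt ⟨s, hs⟩ (Finset.mem_univ _)
    simpa [r, LinearMap.funLeft_apply] using this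
  obtain ⟨f, c, hc, hf⟩ := RCLike.geometric_hahn_banach_point_closed (𝕜 := ℂ)
    ((convex_coeffCone S).linear_image r).closure isClosed_closure hx
  let a : MonoidAlgebra ℂ Γ := ∑ s : F, MonoidAlgebra.single (s : Γ) (f (Pi.single s 1))
  have ha : ∀ (σ : UnitaryRep Γ) (y : σ.space),
      inner ℂ y (σ.onGroupRing a y) = f (r (σ.coeff y)) := fun σ y => by
    conv_rhs => rw [← Finset.univ_sum_single (r (σ.coeff y)), map_sum]
    simp only [a, map_sum, onGroupRing_single, sum_apply, inner_sum, smul_apply, inner_smul_right]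
    refine Finset.sum_congr rfl fun s _ => ?_
    have : Pi.single s (r (σ.coeff y) s) = σ.coeff y s • (Pi.single s 1 : F → ℂ) := by
      rw [← Pi.single_smul, smul_eq_mul, mul_one]
      rfl
    rw [this, map_smul, smul_eq_mul, mul_comm]
    rfl
  have hf' : ∀ φ ∈ coeffCone S, c < (f (r φ)).re := fun φ hφ => hf _ (subset_closure ⟨φ, hφ, rfl⟩)
  have hc0 : c < 0 := by simpa using hf' 0 (zero_mem _)
  refine ⟨a, x, ?_, fun σ hσ y => ?_⟩
  · rw [ha]
    exact hc.trans hc0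
  · rw [ha]
    by_contra! hneg
    -- A negative value on the cone could be rescaled to equal exactly `c`, against the strict
    -- bound.
    have h1 := hf' _ (smul_mem_coeffCone (r := c / (f (r (σ.coeff y))).re)
      (div_nonneg_of_nonpos hc0.le hneg.le) (coeff_mem_coeffCone hσ y))
    have h2 : f (((c / (f (r (σ.coeff y))).re : ℝ)) • r (σ.coeff y)) =
        ((c / (f (r (σ.coeff y))).re : ℝ) : ℂ) * f (r (σ.coeff y)) := by
      rw [f.map_smul_of_tower, Complex.real_smul]
    rw [map_smul, h2, Complex.re_ofReal_mul, div_mul_cancel₀ _ hneg.ne] at h1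
    exact lt_irrefl _ h1

open PreGroupCStar in
/-- A representation that is bounded by the seminorm of `S` is weakly contained in `S`. -/
theorem weaklyContains_of_norm_act_le {S : Set (UnitaryRep Γ)} {π : UnitaryRep Γ}
    (h : ∀ x : PreGroupCStar S, ‖act π x‖ ≤ ‖x‖) : WeaklyContains S π := by
  by_contra hcon
  obtain ⟨a, x, hx, ha⟩ := exists_re_inner_neg_of_not_weaklyContains hcon
  -- Symmetrizing doubles the real parts and makes `b` positive in every representation in `S`.
  set b : PreGroupCStar S := of S a + star (of S a)
  have hb : ∀ (σ : UnitaryRep Γ) (y : σ.space),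
      (inner ℂ y (act σ b y)).re = 2 * (inner ℂ y (σ.onGroupRing a y)).re := fun σ y => by
    have h1 : (inner ℂ y (act σ (star (of S a)) y)).re = (inner ℂ y (act σ (of S a) y)).re := by
      rw [act_star, ContinuousLinearMap.star_eq_adjoint, ContinuousLinearMap.adjoint_inner_right]
      exact inner_re_symm (𝕜 := ℂ) _ _
    rw [map_add, add_apply, inner_add_right, Complex.add_re, h1, two_mul]
    rfl
  have hpos : ∀ σ ∈ S, 0 ≤ act σ b := fun σ hσ => by
    have hsa : IsSelfAdjoint (act σ b) := by
      rw [isSelfAdjoint_iff, ← act_star, star_add, star_star, add_comm]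
    rw [ContinuousLinearMap.nonneg_iff_isPositive, ContinuousLinearMap.isPositive_def']
    refine ⟨hsa, fun y => ?_⟩
    have h2 : 0 ≤ (inner ℂ y (act σ b y)).re := by
      rw [hb]
      exact mul_nonneg zero_le_two (ha σ hσ y)
    rw [ContinuousLinearMap.reApplyInnerSelf_apply]
    exact h2.trans_eq (inner_re_symm (𝕜 := ℂ) _ _)
  have hact : ∀ σ : UnitaryRep Γ, act σ (algebraMap ℂ (PreGroupCStar S) (‖b‖ : ℂ) - b) =
      algebraMap ℝ _ ‖b‖ - act σ b := fun σ => by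
    rw [map_sub, AlgHom.commutes]
    rfl
  -- Positivity is encoded as a norm bound, which the hypothesis transports to `π`; it then forces
  -- `⟨π(b)x, x⟩` to have nonnegative real part.
  have hz : ‖algebraMap ℂ (PreGroupCStar S) (‖b‖ : ℂ) - b‖ ≤ ‖b‖ :=
    norm_le (norm_nonneg b) fun σ hσ => by
      rw [hact]
      exact norm_algebraMap_sub_le (hpos σ hσ) (norm_act_le hσ b)
  have h3 := (h _).trans hz
  rw [hact] at h3
  have h4 : (inner ℂ x ((algebraMap ℝ (π.space →L[ℂ] π.space) ‖b‖ - act π b) x)).re ≤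
      ‖x‖ * (‖b‖ * ‖x‖) :=
    (Complex.re_le_norm _).trans ((norm_inner_le_norm _ _).trans
      (mul_le_mul_of_nonneg_left (ContinuousLinearMap.le_of_opNorm_le _ h3 x) (norm_nonneg x)))
  have h5 : (inner ℂ x (algebraMap ℝ (π.space →L[ℂ] π.space) ‖b‖ x)).re = ‖x‖ * (‖b‖ * ‖x‖) := by
    have : algebraMap ℝ (π.space →L[ℂ] π.space) ‖b‖ x = (‖b‖ : ℂ) • x := rfl
    have h6 : (inner ℂ x x).re = ‖x‖ ^ 2 := inner_self_eq_norm_sq (𝕜 := ℂ) x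
    rw [this, inner_smul_right, Complex.re_ofReal_mul, h6]
    ring
  rw [sub_apply, inner_sub_right, Complex.sub_re, h5, hb] at h4
  linarith

/-! ### The trivial representation -/

variable (Γ) in
/-- The trivial representation on a one-dimensional Hilbert space. -/
def trivialRep : UnitaryRep Γ := ofIsometric (EuclideanSpace ℂ PUnit.{u + 1}) 1 fun _ _ => rfl

lemma op_trivialRep (s : Γ) : (trivialRep Γ).op s = 1 := rfl

/-- Conjugation acts trivially, so any state will do; a unit vector gives one. -/
lemma isAmenable_trivialRep : (trivialRep Γ).IsAmenable := by
  let e : (trivialRep Γ).space := EuclideanSpace.single PUnit.unit (1 : ℂ)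
  have he : ‖e‖ = 1 := by
    change ‖EuclideanSpace.single PUnit.unit (1 : ℂ)‖ = 1
    simp
  refine ⟨PositiveLinearMap.mk₀ (vectorFunctional e e).toLinearMap fun T hT => ?_, ?_,
    fun s T => ?_⟩
  · exact ((ContinuousLinearMap.nonneg_iff_isPositive T).1 hT).inner_nonneg_right e
  · change inner ℂ e e = (1 : ℂ)
    rw [inner_self_eq_norm_sq_to_K, he]
    simp
  · rw [op_trivialRep, op_trivialRep, one_mul, mul_one]

end UnitaryRep

/-! ### Comparison of completions and the main theorem -/

namespace GroupCStar

open UniformSpace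

variable {Γ : Type u} [Group Γ] {S T : Set (UnitaryRep Γ)}

lemma norm_of (x : MonoidAlgebra ℂ Γ) : ‖of S x‖ = ‖PreGroupCStar.of S x‖ := norm_coe _

/-- The isomorphism of completions induced by the equality of two seminorms. -/
theorem exists_starAlgEquiv (h : ∀ x : MonoidAlgebra ℂ Γ,
    ‖PreGroupCStar.of S x‖ = ‖PreGroupCStar.of T x‖) :
    ∃ φ : GroupCStar S ≃⋆ₐ[ℂ] GroupCStar T, ∀ x : MonoidAlgebra ℂ Γ, φ (of S x) = of T x := by
  let e : PreGroupCStar S ≃ₐ[ℂ] PreGroupCStar T :=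
    (PreGroupCStar.of S).symm.trans (PreGroupCStar.of T)
  have he : Isometry e := AddMonoidHomClass.isometry_of_norm e fun x => (h x).symm
  have he' : Isometry e.symm := AddMonoidHomClass.isometry_of_norm e.symm fun x => h x
  obtain ⟨ψ, hψ, hψc⟩ : ∃ ψ : GroupCStar S ≃+* GroupCStar T,
      (∀ x : PreGroupCStar S, ψ (coe x) = coe (e x)) ∧ Continuous ψ :=
    ⟨Completion.mapRingEquiv e.toRingEquiv he.continuous he'.continuous,
      fun x => Completion.map_coe he.uniformContinuous x, Completion.continuous_map⟩
  have hstar : ∀ x : PreGroupCStar S, e (star x) = star (e x) := fun _ => rfl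
  refine ⟨{ ψ with map_star' := fun x => ?_, map_smul' := fun c x => ?_ }, fun x => hψ _⟩
  · change ψ (star x) = star (ψ x)
    refine denseRange_coe.induction_on x
      (isClosed_eq (hψc.comp continuous_star) hψc.star) fun a => ?_
    rw [star_coe, hψ, hψ, star_coe, hstar]
  · change ψ (c • x) = c • ψ x
    refine denseRange_coe.induction_on x
      (isClosed_eq (hψc.comp (continuous_const_smul c)) (hψc.const_smul c)) fun a => ?_
    rw [← coe_smul, hψ, hψ, ← coe_smul, map_smul]

end GroupCStar

end

theorem mainTheorem4 {Γ : Type u} [Group Γ] (D : Ideal (lp (fun _ : Γ => ℂ) ∞)) :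
    (∃ φ : IdealCompletion D ≃⋆ₐ[ℂ] FullGroupCStar Γ,
        ∀ x : MonoidAlgebra ℂ Γ,
          φ (GroupCStar.of (UnitaryRep.dReps D) x) = GroupCStar.of Set.univ x) ↔
      ∃ π : UnitaryRep Γ, π.IsAmenable ∧ UnitaryRep.WeaklyContains (UnitaryRep.dReps D) π := by
  constructor
  · rintro ⟨φ, hφ⟩
    refine ⟨UnitaryRep.trivialRep Γ, UnitaryRep.isAmenable_trivialRep,
      UnitaryRep.weaklyContains_of_norm_act_le fun x => ?_⟩
    let a : MonoidAlgebra ℂ Γ := (PreGroupCStar.of _).symm x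
    calc ‖PreGroupCStar.act (UnitaryRep.trivialRep Γ) x‖
        ≤ ‖PreGroupCStar.of Set.univ a‖ :=
          PreGroupCStar.norm_act_le (Set.mem_univ _) (PreGroupCStar.of Set.univ a)
      _ = ‖φ (GroupCStar.of (UnitaryRep.dReps D) a)‖ := by rw [hφ, GroupCStar.norm_of]
      _ = ‖GroupCStar.of (UnitaryRep.dReps D) a‖ := StarAlgEquiv.norm_map φ _
      _ = ‖x‖ := GroupCStar.norm_of a
  · rintro ⟨π, hπ, h⟩
    refine GroupCStar.exists_starAlgEquiv fun x => le_antisymm ?_ ?_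
    · exact PreGroupCStar.norm_le (norm_nonneg _) fun σ _ =>
        PreGroupCStar.norm_act_le (Set.mem_univ σ) (PreGroupCStar.of Set.univ x)
    · exact PreGroupCStar.norm_le (norm_nonneg _) fun ρ _ =>
        PreGroupCStar.norm_act_le_of_weaklyContains
          (UnitaryRep.weaklyContains_of_isAmenable hπ h ρ) (PreGroupCStar.of _ x)
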